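/- **Definitions.** All alphabets are finite. An *indexed grammar* is $G=(V,\Sigma,I,P,S)$ with finite pairwise disjoint sets $V$ (nonterminals), $\Sigma$ (terminals), $I$ (indices), start nonterminal $S\in V$, and a finite set $P$ of productions, each of the form (1) $A\to\nu$, (2) $A\to Bf$ or (3) $Af\to\nu$, where $A,B\in V$, $f\in I$, $\nu\in(V\cup\Sigma)^*$. Sentential forms are words in $(VI^*\cup\Sigma)^*$. In one step, an occurrence of $A\alpha$ ($A\in V$, $\alpha$ its entire index string in $I^*$) is replaced: by production (1) with $\nu$ in which $\alpha$ is attached to every nonterminal; by (2) with $Bf\alpha$; by (3), when $\alpha=f\alpha'$, with $\nu$ in which $\alpha'$ is attached to every nonterminal. $L(G)$ is the set of words in $\Sigma^*$ derivable from $S$ in finitely many steps. $G$ is *uncontrolled finite-index* if there is an $r$ such that every sentential form in every successful derivation (one from $S$ to a word in $\Sigma^*$) has at most $r$ occurrences of nonterminals. An *indexed grammar with $k$ counters* has productions $\alpha\to(\beta,c_1,\dots,c_k)$, where $\alpha\to\beta$ is a production of form (1), (2) or (3) and $c_i\ge 0$ are integers. Sentential forms are $(\nu,n_1,\dots,n_k)$;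 a step acts on $\nu$ as above and adds $c_i$ to $n_i$ for each $i$. It generates $\{u\in\Sigma^* : (S,0,\dots,0)\Rightarrow^*(u,n_1,\dots,n_k),\ n_1=\dots=n_k\}$. It is *uncontrolled finite-index* if the underlying indexed grammar, obtained by deleting the counter components, is. An *NCM language* is a language accepted, for some $k$ and $l$, by a one-way nondeterministic finite-state machine with moves that may read no input and with $k$ counters. The counters hold nonnegative integers, are initially zero, can be tested for zero, and change by $-1$, $0$ or $1$ in each move. The machine accepts by final state after reading the whole input, and must be $l$-reversal-bounded: in every accepting computation each counter makes at most $l$ changes between non-decreasing and non-increasing. **Proposition.** Let $L\subseteq\Sigma^*$ be a language over a finite alphabet. Then $L$ is generated by an uncontrolled finite-index indexed grammar with $k$ counters, for some $k\ge 0$, if and only if there are a finite alphabet $\Gamma$, a monoid homomorphism $h:\Gamma^*\to\Sigma^*$ (possibly erasing letters), a language $L_1\subseteq\Gamma^*$ generated by an uncontrolled finite-index indexed grammar (without counters), and an NCM language $L_2\subseteq\Gamma^*$ such that $L=h(L_1\cap L_2)$. -/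

import Mathlib

/-! ### Indexed grammars -/

/-- Productions of an indexed grammar with terminals `T`, nonterminals `N` and indices `I`. -/
inductive IndexedProduction (T N I : Type*) where
  /-- `A → ν` with `ν` a word over nonterminals and terminals -/
  | expand (A : N) (ν : List (Symbol T N))
  /-- `A → B f` -/
  | push (A B : N) (f : I)
  /-- `A f → ν` with `ν` a word over nonterminals and terminals -/
  | pop (A : N) (f : I) (ν : List (Symbol T N))

/-- Sentential forms: words over terminals and nonterminals that carry a stack of indices.
The head of the list of indices is the index next to the nonterminal (the top of the stack). -/
abbrev IndexedForm (T N I : Type*) := List (Symbol T (N × List I))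

namespace IndexedForm

/-- Attach the stack `α` to a nonterminal; terminals are left unchanged. -/
def attachSymbol {T N I : Type*} (α : List I) : Symbol T N → Symbol T (N × List I)
  | .terminal a => .terminal a
  | .nonterminal C => .nonterminal (C, α)

/-- Turn `w₁ C₁ ⋯ w_ℓ C_ℓ w_{ℓ+1}` into `w₁ C₁ α ⋯ w_ℓ C_ℓ α w_{ℓ+1}`. -/
def attach {T N I : Type*} (α : List I) (ν : List (Symbol T N)) : IndexedForm T N I :=
  ν.map (attachSymbol α)

/-- A terminal word regarded as a sentential form. -/
def ofWord {T : Type*} (N I : Type*) (w : List T) : IndexedForm T N I :=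
  w.map Symbol.terminal

/-- Whether a symbol of a sentential form is a nonterminal. -/
def isNonterminal {T N I : Type*} : Symbol T (N × List I) → Bool
  | .terminal _ => false
  | .nonterminal _ => true

/-- The number of occurrences of nonterminals in a sentential form. -/
def numNonterminals {T N I : Type*} (x : IndexedForm T N I) : ℕ :=
  x.countP isNonterminal

end IndexedForm

namespace IndexedProduction

/-- `p.Replaces A α β`: the production `p` may replace the nonterminal `A` with stack `α`
by the sentential form `β`. -/
inductive Replaces {T N I : Type*} :
    IndexedProduction T N I → N → List I → IndexedForm T N I → Prop
  | expand (A : N) (ν : List (Symbol T N)) (α : List I) :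
      Replaces (.expand A ν) A α (IndexedForm.attach α ν)
  | push (A B : N) (f : I) (α : List I) :
      Replaces (.push A B f) A α [Symbol.nonterminal (B, f :: α)]
  | pop (A : N) (f : I) (ν : List (Symbol T N)) (α : List I) :
      Replaces (.pop A f ν) A (f :: α) (IndexedForm.attach α ν)

/-- `p.Rewrites x y`: the sentential form `y` results from `x` by applying the production `p`
to one occurrence of a nonterminal. -/
def Rewrites {T N I : Type*} (p : IndexedProduction T N I) (x y : IndexedForm T N I) : Prop :=
  ∃ (u v : IndexedForm T N I) (A : N) (α : List I) (β : IndexedForm T N I),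
    p.Replaces A α β ∧ x = u ++ [Symbol.nonterminal (A, α)] ++ v ∧ y = u ++ β ++ v

end IndexedProduction

/-- An indexed grammar with terminal alphabet `T`. -/
structure IndexedGrammar (T : Type*) where
  /-- the nonterminals -/
  NT : Type
  /-- the indices -/
  Idx : Type
  finiteNT : Finite NT
  finiteIdx : Finite Idx
  /-- the start nonterminal -/
  start : NT
  /-- the finite set of productions -/
  productions : Finset (IndexedProduction T NT Idx)

namespace IndexedGrammar

/-- One derivation step. -/
def Produces {T : Type*} (G : IndexedGrammar T) (x y : IndexedForm T G.NT G.Idx) : Prop :=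
  ∃ p ∈ G.productions, p.Rewrites x y

/-- The reflexive and transitive closure of the one-step relation. -/
def Derives {T : Type*} (G : IndexedGrammar T) :
    IndexedForm T G.NT G.Idx → IndexedForm T G.NT G.Idx → Prop :=
  Relation.ReflTransGen G.Produces

/-- The sentential form consisting of the start nonterminal with the empty stack. -/
def startForm {T : Type*} (G : IndexedGrammar T) : IndexedForm T G.NT G.Idx :=
  [Symbol.nonterminal (G.start, [])]

/-- The language generated by an indexed grammar. -/
def language {T : Type*} (G : IndexedGrammar T) : Language T :=
  {w | G.Derives G.startForm (IndexedForm.ofWord G.NT G.Idx w)}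

/-- `G` is uncontrolled index-`r`: every sentential form `x` occurring in a successful derivation
(a derivation from the start nonterminal to a terminal word) has at most `r` nonterminals. -/
def IsUncontrolledIndex {T : Type*} (G : IndexedGrammar T) (r : ℕ) : Prop :=
  ∀ (x : IndexedForm T G.NT G.Idx) (w : List T),
    G.Derives G.startForm x → G.Derives x (IndexedForm.ofWord G.NT G.Idx w) →
      IndexedForm.numNonterminals x ≤ r

/-- `G` is uncontrolled finite-index. -/
def IsUncontrolledFiniteIndex {T : Type*} (G : IndexedGrammar T) : Prop :=
  ∃ r : ℕ, G.IsUncontrolledIndex r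

end IndexedGrammar

/-! ### Indexed grammars with counters -/

/-- An indexed grammar with `k` (monotonic) counters: every production carries a vector of
nonnegative counter increments. -/
structure CounterIndexedGrammar (T : Type*) (k : ℕ) where
  /-- the nonterminals -/
  NT : Type
  /-- the indices -/
  Idx : Type
  finiteNT : Finite NT
  finiteIdx : Finite Idx
  /-- the start nonterminal -/
  start : NT
  /-- the finite set of productions `α → (β, c₁, …, c_k)` -/
  productions : Finset (IndexedProduction T NT Idx × (Fin k → ℕ))

namespace CounterIndexedGrammar

open Classical in
/-- The underlying grammar: the counter components of the productions are removed. -/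
noncomputable def underlying {T : Type*} {k : ℕ} (G : CounterIndexedGrammar T k) :
    IndexedGrammar T where
  NT := G.NT
  Idx := G.Idx
  finiteNT := G.finiteNT
  finiteIdx := G.finiteIdx
  start := G.start
  productions := G.productions.image Prod.fst

/-- One derivation step on a sentential form together with the `k` counter values. -/
def Produces {T : Type*} {k : ℕ} (G : CounterIndexedGrammar T k)
    (x y : IndexedForm T G.NT G.Idx × (Fin k → ℕ)) : Prop :=
  ∃ p ∈ G.productions, p.1.Rewrites x.1 y.1 ∧ y.2 = x.2 + p.2

/-- The reflexive and transitive closure of the one-step relation. -/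
def Derives {T : Type*} {k : ℕ} (G : CounterIndexedGrammar T k) :
    IndexedForm T G.NT G.Idx × (Fin k → ℕ) → IndexedForm T G.NT G.Idx × (Fin k → ℕ) → Prop :=
  Relation.ReflTransGen G.Produces

/-- The language generated: the terminal words that can be derived, starting with all counters
at zero, with all counters equal at the end. -/
def language {T : Type*} {k : ℕ} (G : CounterIndexedGrammar T k) : Language T :=
  {w | ∃ n : Fin k → ℕ,
    G.Derives ([Symbol.nonterminal (G.start, [])], 0) (IndexedForm.ofWord G.NT G.Idx w, n) ∧
      ∀ i j, n i = n j}

end CounterIndexedGrammar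

/-! ### Reversal-bounded multicounter machines -/

/-- A transition of a `k`-counter machine: in state `src`, reading `read` (an input letter, or
`none` for a move that reads no input), when exactly the counters `i` with `positive i = true` are
nonzero, go to state `tgt` and change counter `i` by `change i ∈ {-1, 0, 1}`. -/
structure CounterTransition (T Q : Type*) (k : ℕ) where
  src : Q
  read : Option T
  positive : Fin k → Bool
  tgt : Q
  change : Fin k → SignType

/-- A one-way nondeterministic `k`-counter machine with input alphabet `T`. -/
structure CounterMachine (T : Type*) (k : ℕ) where
  State : Type
  finiteState : Finite State
  start : State
  accept : Set State
  transitions : Finset (CounterTransition T State k)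

/-- A configuration: the state, the input still to be read, and the counter values. -/
structure CounterConfig (T Q : Type*) (k : ℕ) where
  state : Q
  input : List T
  counter : Fin k → ℕ

/-- The number of changes between non-decreasing and non-increasing phases in a sequence of
counter values; the Boolean says whether the current phase is a non-increasing one. -/
def counterReversals : Bool → List ℕ → ℕ
  | d, x :: y :: l =>
      if x < y then (if d then 1 else 0) + counterReversals false (y :: l)
      else if y < x then (if d then 0 else 1) + counterReversals true (y :: l)
      else counterReversals d (y :: l)
  | _, _ => 0

namespace CounterMachine

/-- One step of the machine. (A zero counter cannot be decremented: counter values are natural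
numbers.) -/
def Step {T : Type*} {k : ℕ} (M : CounterMachine T k) (c d : CounterConfig T M.State k) : Prop :=
  ∃ t ∈ M.transitions,
    c.state = t.src ∧ d.state = t.tgt ∧ c.input = t.read.toList ++ d.input ∧
      ∀ i, (0 < c.counter i ↔ t.positive i = true) ∧
        (d.counter i : ℤ) = (c.counter i : ℤ) + (t.change i : ℤ)

/-- The initial configuration on input `w`: start state, all counters zero. -/
def initial {T : Type*} {k : ℕ} (M : CounterMachine T k) (w : List T) :
    CounterConfig T M.State k where
  state := M.start
  input := w
  counter := 0

/-- `C` is the sequence of configurations of an accepting computation of `M` on `w`: it starts in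
the initial configuration, and ends in an accepting state with the whole input read. -/
def IsAcceptingComputation {T : Type*} {k : ℕ} (M : CounterMachine T k) (w : List T)
    (C : List (CounterConfig T M.State k)) : Prop :=
  C.IsChain M.Step ∧ C.head? = some (M.initial w) ∧
    ∃ c, C.getLast? = some c ∧ c.state ∈ M.accept ∧ c.input = []

/-- The language accepted by the machine. -/
def language {T : Type*} {k : ℕ} (M : CounterMachine T k) : Language T :=
  {w | ∃ C, M.IsAcceptingComputation w C}

/-- `M` is `l`-reversal-bounded: in every accepting computation, every counter makes at most `l`
changes between non-decreasing and non-increasing. (Counters start at zero, so the first phase is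
non-decreasing.) -/
def IsReversalBounded {T : Type*} {k : ℕ} (M : CounterMachine T k) (l : ℕ) : Prop :=
  ∀ (w : List T) (C : List (CounterConfig T M.State k)), M.IsAcceptingComputation w C →
    ∀ i, counterReversals false (C.map fun c => c.counter i) ≤ l

end CounterMachine

/-! ### The language families, and homomorphic images -/

namespace Language

/-- `L` is generated by an uncontrolled finite-index indexed grammar. -/
def IsUFIN {T : Type*} (L : Language T) : Prop :=
  ∃ G : IndexedGrammar T, G.IsUncontrolledFiniteIndex ∧ G.language = L

/-- `L` is generated by an uncontrolled finite-index indexed grammar with `k` counters, for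
some `k`. -/
def IsUFINc {T : Type*} (L : Language T) : Prop :=
  ∃ (k : ℕ) (G : CounterIndexedGrammar T k),
    G.underlying.IsUncontrolledFiniteIndex ∧ G.language = L

/-- `L` is accepted by a one-way nondeterministic `l`-reversal-bounded `k`-counter machine, for
some `k` and `l`. -/
def IsNCM {T : Type*} (L : Language T) : Prop :=
  ∃ (k l : ℕ) (M : CounterMachine T k), M.IsReversalBounded l ∧ M.language = L

/-- The image of a language under a homomorphism of free monoids. -/
def homImage {S T : Type*} (h : FreeMonoid S →* FreeMonoid T) (L : Language S) : Language T :=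
  {w | ∃ v ∈ L, h (FreeMonoid.ofList v) = FreeMonoid.ofList w}

end Language

/-! Both directions work with productions weighted in a commutative monoid: `Fin k → ℕ` for grammars
with counters, `Unit` for plain grammars. Derivations are replaced by derivation trees
(`derives_iff_yields`), and the index is carried over by maps of sentential forms that keep
derivability and do not lower the number of nonterminals (`IsIndex.of_simulation`), or, for
substitutions, by lifting derivations.

From counters to an intersection: let every production write its increments as letters, `c i` copies
of a letter `i`. The counters are equal at the end exactly when these letters occur equally often,
and a homomorphism erases them (`yields_iff_exists_rec`). Words with equal letter counts are
recognised by a machine that counts up while reading and then empties all counters simultaneously,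
with one reversal (`equalCounts_isNCM`).

From an intersection to counters, four reductions are composed. (a) A reversal-bounded counter
passes through boundedly many segments, in each of which its changes do not differ in sign. Hence
its zero tests can be verified afterwards, from the values at the ends of the segments
(`valid_append_of_check`). A finite automaton guesses the segments and counts the moves of each
sort; the word is accepted when the resulting vector lies in a semilinear set
(`mem_language_iff_run`). (b) Semilinear acceptance is reduced to equality of counters: every
coordinate is doubled, a member of a linear set is guessed in one copy, the automaton runs on the
other, and padding both copies equally makes all counters equal exactly when the two copies agree
(`exists_guessRules_iff`). (c) The grammar is combined with the weighted automaton by the triple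
construction, with nonterminals `(p, A, q)`. A right-hand side is scanned inside a single
nonterminal before it is released, so a form of the product has as many nonterminals as the form
that it simulates (`yields_productRules_iff`, `IsIndex.product`). (d) A homomorphism is applied to
the terminals in the right-hand sides (`yields_subst_iff`, `IsIndex.subst`). -/

theorem Relation.ReflTransGen.map_of_forall {α β : Type*} {r : α → α → Prop} {p : β → β → Prop}
    (f : α → β) (h : ∀ a b, r a b → Relation.ReflTransGen p (f a) (f b)) {a b : α}
    (hab : Relation.ReflTransGen r a b) : Relation.ReflTransGen p (f a) (f b) :=
  Relation.ReflTransGen.lift' f h a b hab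

/-! ### Weighted indexed productions -/

namespace WeightedIndexed

open Relation

variable {T N I M : Type*} [AddCommMonoid M]

/-- One derivation step with respect to a set of productions with weights in `M`; the second
component of a configuration accumulates the weights. -/
def Step (P : Set (IndexedProduction T N I × M)) (x y : IndexedForm T N I × M) : Prop :=
  ∃ p ∈ P, p.1.Rewrites x.1 y.1 ∧ y.2 = x.2 + p.2

/-- The reflexive and transitive closure of the one-step relation. -/
def Derives (P : Set (IndexedProduction T N I × M)) :
    IndexedForm T N I × M → IndexedForm T N I × M → Prop :=
  ReflTransGen (Step P)

/-- Every sentential form of a successful derivation has at most `r` nonterminals. -/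
def IsIndex (P : Set (IndexedProduction T N I × M)) (A : N) (r : ℕ) : Prop :=
  ∀ (x : IndexedForm T N I) (w : List T) (m m' : M),
    Derives P ([Symbol.nonterminal (A, [])], 0) (x, m) →
      Derives P (x, m) (IndexedForm.ofWord N I w, m') → IndexedForm.numNonterminals x ≤ r

/-- Big-step semantics: `Yields P x w n` if the terminal word `w` can be derived from `x` with
total weight `n`. -/
inductive Yields (P : Set (IndexedProduction T N I × M)) :
    IndexedForm T N I → List T → M → Prop
  | nil : Yields P [] [] 0
  | terminal {a : T} {x : IndexedForm T N I} {w : List T} {n : M} (h : Yields P x w n) :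
      Yields P (.terminal a :: x) (a :: w) n
  | nonterminal {p : IndexedProduction T N I × M} {A : N} {α : List I}
      {β x : IndexedForm T N I} {w₁ w₂ : List T} {n₁ n₂ : M} (hp : p ∈ P)
      (hr : p.1.Replaces A α β) (h₁ : Yields P β w₁ n₁) (h₂ : Yields P x w₂ n₂) :
      Yields P (.nonterminal (A, α) :: x) (w₁ ++ w₂) (p.2 + n₁ + n₂)

variable {P : Set (IndexedProduction T N I × M)}

theorem Step.context {x y : IndexedForm T N I} {m m' : M} (h : Step P (x, m) (y, m'))
    (u v : IndexedForm T N I) (c : M) : Step P (u ++ x ++ v, c + m) (u ++ y ++ v, c + m') := by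
  obtain ⟨p, hp, ⟨u', v', A, α, β, hr, hx, hy⟩, hm⟩ := h
  simp only at hx hy hm
  subst hx hy hm
  exact ⟨p, hp, ⟨u ++ u', v' ++ v, A, α, β, hr, by simp, by simp⟩, by simp [add_assoc]⟩

theorem Derives.context {x y : IndexedForm T N I} {m m' : M} (h : Derives P (x, m) (y, m'))
    (u v : IndexedForm T N I) (c : M) :
    Derives P (u ++ x ++ v, c + m) (u ++ y ++ v, c + m') :=
  ReflTransGen.map_of_forall (fun z : IndexedForm T N I × M => (u ++ z.1 ++ v, c + z.2))
    (fun _ _ hz => .single (Step.context hz u v c)) h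

/-- The tree is traversed depth first from left to right: apply the production, finish its subtree
with the rest as right context, then derive the rest behind the finished word. -/
theorem Yields.derives {x : IndexedForm T N I} {w : List T} {n : M} (h : Yields P x w n) :
    Derives P (x, 0) (IndexedForm.ofWord N I w, n) := by
  induction h with
  | nil => exact ReflTransGen.refl
  | @terminal a x w n h ih => simpa [IndexedForm.ofWord] using ih.context [.terminal a] [] 0
  | @nonterminal p A α β x w₁ w₂ n₁ n₂ hp hr h₁ h₂ ih₁ ih₂ =>
    have h0 : Step P (.nonterminal (A, α) :: x, 0) (β ++ x, p.2) :=
      ⟨p, hp, ⟨[], x, A, α, β, hr, by simp, by simp⟩, by simp⟩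
    have h1 := ih₁.context [] x p.2
    have h2 := ih₂.context (IndexedForm.ofWord N I w₁) [] (p.2 + n₁)
    simp only [List.nil_append, List.append_nil, add_zero] at h1 h2
    refine (ReflTransGen.head h0 h1).trans ?_
    simpa [IndexedForm.ofWord, Derives] using h2

theorem Yields.append {x y : IndexedForm T N I} {w₁ w₂ : List T} {n₁ n₂ : M}
    (hx : Yields P x w₁ n₁) (hy : Yields P y w₂ n₂) :
    Yields P (x ++ y) (w₁ ++ w₂) (n₁ + n₂) := by
  induction hx with
  | nil => simpa using hy
  | terminal h ih => exact .terminal ih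
  | nonterminal hp hr h₁ h₂ ih₁ ih₂ =>
    have := Yields.nonterminal hp hr h₁ ih₂
    simpa [add_assoc] using this

theorem Yields.of_append {x y : IndexedForm T N I} {w : List T} {n : M}
    (h : Yields P (x ++ y) w n) :
    ∃ w₁ w₂ n₁ n₂, w = w₁ ++ w₂ ∧ n = n₁ + n₂ ∧ Yields P x w₁ n₁ ∧ Yields P y w₂ n₂ := by
  induction x generalizing w n with
  | nil => exact ⟨[], w, 0, n, rfl, by simp, .nil, h⟩
  | cons s x ih =>
    cases h with
    | terminal h =>
      obtain ⟨w₁, w₂, n₁, n₂, rfl, rfl, h₁, h₂⟩ := ih h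
      exact ⟨_, w₂, n₁, n₂, rfl, rfl, .terminal h₁, h₂⟩
    | nonterminal hp hr h₁ h₂ =>
      obtain ⟨w₁, w₂, n₁, n₂, rfl, rfl, h₃, h₄⟩ := ih h₂
      exact ⟨_, w₂, _, n₂, by simp, by rw [add_assoc _ n₁ n₂],
        .nonterminal hp hr h₁ h₃, h₄⟩

theorem Yields.ofWord (w : List T) : Yields P (IndexedForm.ofWord N I w) w 0 := by
  induction w with
  | nil => exact .nil
  | cons a w ih => exact .terminal ih

/-- The forest of `y` is cut around the inserted form, and the middle part becomes the children of a
new node. Commutativity of the weights brings the weight of this node to the front, wherever the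
replaced occurrence stands. -/
theorem Step.yields {x y : IndexedForm T N I} {m c n : M} {w : List T}
    (h : Step P (x, m) (y, c)) (hy : Yields P y w n) :
    ∃ d, c = m + d ∧ Yields P x w (d + n) := by
  obtain ⟨p, hp, ⟨u, v, A, α, β, hr, hx, hy'⟩, hm⟩ := h
  simp only at hx hy' hm
  subst hx hy'
  obtain ⟨w₁, w₂, n₁, n₂, rfl, rfl, h₁, h₂⟩ := hy.of_append
  obtain ⟨w₃, w₄, n₃, n₄, rfl, rfl, h₃, h₄⟩ := h₁.of_append
  refine ⟨p.2, hm, ?_⟩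
  have := (h₃.append (Yields.nonterminal hp hr h₄ .nil)).append h₂
  simp only [List.append_nil, add_zero] at this
  rwa [show n₃ + (p.2 + n₄) + n₂ = p.2 + (n₃ + n₄ + n₂) by abel] at this

theorem Derives.yields {x : IndexedForm T N I} {w : List T} {m n : M}
    (h : Derives P (x, m) (IndexedForm.ofWord N I w, n)) :
    ∃ d, n = m + d ∧ Yields P x w d := by
  obtain ⟨z, hz⟩ : ∃ z, z = (x, m) := ⟨_, rfl⟩
  unfold Derives at h
  rw [← hz] at h
  induction h using ReflTransGen.head_induction_on generalizing x m with
  | refl => cases hz; exact ⟨0, by simp, .ofWord w⟩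
  | @head a b hab _ ih =>
    subst hz
    obtain ⟨d, rfl, hd⟩ := ih (x := b.1) (m := b.2) rfl
    obtain ⟨e, he, h⟩ := Step.yields hab hd
    exact ⟨e + d, by rw [he, add_assoc], h⟩

/-- Trees forget the order of the steps and split along concatenations, so later arguments can be
inductions over right-hand sides. -/
theorem derives_iff_yields {x : IndexedForm T N I} {w : List T} {n : M} :
    Derives P (x, 0) (IndexedForm.ofWord N I w, n) ↔ Yields P x w n := by
  refine ⟨fun h => ?_, Yields.derives⟩
  obtain ⟨d, rfl, hd⟩ := h.yields
  simpa using hd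

/-- The uncontrolled index is inherited along a map of sentential forms that preserves
derivability and the number of nonterminals. -/
theorem IsIndex.of_simulation {T' N' I' M' : Type*} [AddCommMonoid M']
    {P' : Set (IndexedProduction T' N' I' × M')} {A : N} {A' : N'} {r : ℕ}
    (h : IsIndex P A r) (φ : IndexedForm T' N' I' → IndexedForm T N I)
    (μ : IndexedForm T' N' I' × M' → M)
    (hstep : ∀ x y, Step P' x y → Derives P (φ x.1, μ x) (φ y.1, μ y))
    (hstart : φ [.nonterminal (A', [])] = [.nonterminal (A, [])])
    (hstart' : μ ([.nonterminal (A', [])], 0) = 0)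
    (hnum : ∀ x, IndexedForm.numNonterminals x ≤ IndexedForm.numNonterminals (φ x))
    (hword : ∀ w, ∃ v, φ (IndexedForm.ofWord N' I' w) = IndexedForm.ofWord N I v) :
    IsIndex P' A' r := by
  intro x w m m' h₁ h₂
  have key : ∀ {x y}, Derives P' x y → Derives P (φ x.1, μ x) (φ y.1, μ y) := fun {x y} hxy =>
    ReflTransGen.map_of_forall (fun z : IndexedForm T' N' I' × M' => (φ z.1, μ z)) hstep hxy
  have e₁ := key h₁
  have e₂ := key h₂
  obtain ⟨v, hv⟩ := hword w
  simp only [hstart, hstart', hv] at e₁ e₂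
  exact (hnum x).trans (h _ _ _ _ e₁ e₂)

end WeightedIndexed

/-! ### Grammars with and without counters as weighted grammars -/

open WeightedIndexed Relation

theorem CounterIndexedGrammar.underlying_produces_iff {T : Type*} {k : ℕ}
    (G : CounterIndexedGrammar T k) (x y : IndexedForm T G.NT G.Idx) :
    G.underlying.Produces x y ↔ ∃ p ∈ G.productions, p.1.Rewrites x y := by
  classical
  constructor
  · rintro ⟨p, hp, h⟩
    obtain ⟨q, hq, rfl⟩ := Finset.mem_image.1 hp
    exact ⟨q, hq, h⟩
  · rintro ⟨q, hq, h⟩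
    exact ⟨q.1, Finset.mem_image_of_mem _ hq, h⟩

/-- Increments never block a step, so every derivation of the underlying grammar lifts, from any
initial counter values. This is why `IsIndex` quantifies over all weights and imposes no condition
on the final ones. -/
theorem CounterIndexedGrammar.underlying_derives_iff {T : Type*} {k : ℕ}
    (G : CounterIndexedGrammar T k) (x y : IndexedForm T G.NT G.Idx) (m : Fin k → ℕ) :
    G.underlying.Derives x y ↔
      ∃ m', WeightedIndexed.Derives (↑G.productions) (x, m) (y, m') := by
  constructor
  · intro h
    induction h with
    | refl => exact ⟨m, ReflTransGen.refl⟩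
    | tail _ h ih =>
      obtain ⟨m', hm'⟩ := ih
      obtain ⟨p, hp, hr⟩ := (G.underlying_produces_iff _ _).1 h
      exact ⟨m' + p.2, hm'.tail ⟨p, hp, hr, rfl⟩⟩
  · rintro ⟨m', h⟩
    exact ReflTransGen.map_of_forall (p := G.underlying.Produces) Prod.fst
      (fun a b ⟨p, hp, hr, _⟩ => .single ((G.underlying_produces_iff _ _).2 ⟨p, hp, hr⟩)) h

theorem CounterIndexedGrammar.underlying_isUncontrolledIndex_iff {T : Type*} {k : ℕ}
    (G : CounterIndexedGrammar T k) (r : ℕ) :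
    G.underlying.IsUncontrolledIndex r ↔
      IsIndex (G.productions : Set (IndexedProduction T G.NT G.Idx × (Fin k → ℕ))) G.start r := by
  constructor
  · intro h x w m m' h₁ h₂
    exact h x w ((G.underlying_derives_iff _ _ 0).2 ⟨_, h₁⟩)
      ((G.underlying_derives_iff _ _ m).2 ⟨_, h₂⟩)
  · intro h x w h₁ h₂
    obtain ⟨m, hm⟩ := (G.underlying_derives_iff _ _ 0).1 h₁
    obtain ⟨m', hm'⟩ := (G.underlying_derives_iff _ _ m).1 h₂
    exact h x w m m' hm hm'

theorem IndexedGrammar.derives_iff {T : Type*} (G : IndexedGrammar T)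
    (x y : IndexedForm T G.NT G.Idx) :
    G.Derives x y ↔
      WeightedIndexed.Derives {p : _ × Unit | p.1 ∈ G.productions} (x, ()) (y, ()) := by
  constructor
  · exact fun h => ReflTransGen.map_of_forall (fun z => (z, ()))
      (fun a b ⟨p, hp, hr⟩ => .single ⟨(p, ()), hp, hr, rfl⟩) h
  · exact fun h => ReflTransGen.map_of_forall (p := G.Produces) Prod.fst
      (fun a b ⟨p, hp, hr, _⟩ => .single ⟨p.1, hp, hr⟩) h

namespace Language

variable {T : Type*}

theorem isUFINc_iff {L : Language T} :
    L.IsUFINc ↔ ∃ (k : ℕ) (N I : Type) (_ : Finite N) (_ : Finite I) (A : N)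
      (P : Set (IndexedProduction T N I × (Fin k → ℕ))) (r : ℕ), P.Finite ∧ IsIndex P A r ∧
        ∀ w, w ∈ L ↔ ∃ n, Yields P [.nonterminal (A, [])] w n ∧ ∀ i j, n i = n j := by
  constructor
  · rintro ⟨k, G, ⟨r, hr⟩, rfl⟩
    refine ⟨k, G.NT, G.Idx, G.finiteNT, G.finiteIdx, G.start, ↑G.productions, r,
      Finset.finite_toSet _, (G.underlying_isUncontrolledIndex_iff r).1 hr, fun w => ?_⟩
    simp only [← derives_iff_yields]
    rfl
  · rintro ⟨k, N, I, _, _, A, P, r, hP, hr, hL⟩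
    let G : CounterIndexedGrammar T k :=
      ⟨N, I, inferInstance, inferInstance, A, hP.toFinset⟩
    have hG : (↑G.productions : Set (IndexedProduction T N I × (Fin k → ℕ))) = P :=
      hP.coe_toFinset
    refine ⟨k, G, ⟨r, (G.underlying_isUncontrolledIndex_iff r).2 (by rwa [hG])⟩, ?_⟩
    ext w
    rw [hL]
    simp only [← derives_iff_yields, ← hG]
    rfl

theorem isUFIN_iff {L : Language T} :
    L.IsUFIN ↔ ∃ (N I : Type) (_ : Finite N) (_ : Finite I) (A : N)
      (P : Set (IndexedProduction T N I × Unit)) (r : ℕ), P.Finite ∧ IsIndex P A r ∧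
        ∀ w, w ∈ L ↔ Yields P [.nonterminal (A, [])] w () := by
  constructor
  · rintro ⟨G, ⟨r, hr⟩, rfl⟩
    refine ⟨G.NT, G.Idx, G.finiteNT, G.finiteIdx, G.start, {p | p.1 ∈ G.productions}, r, ?_, ?_,
      fun w => ?_⟩
    · exact (G.productions.finite_toSet.prod (Set.finite_univ (α := Unit))).subset
        fun p hp => ⟨hp, trivial⟩
    · intro x w m m' h₁ h₂
      exact hr x w ((G.derives_iff _ _).2 h₁) ((G.derives_iff _ _).2 h₂)
    · rw [← derives_iff_yields]
      exact G.derives_iff _ _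
  · rintro ⟨N, I, _, _, A, P, r, hP, hr, hL⟩
    let G : IndexedGrammar T :=
      ⟨N, I, inferInstance, inferInstance, A, (hP.image Prod.fst).toFinset⟩
    have hG : {p : IndexedProduction T N I × Unit | p.1 ∈ G.productions} = P := by
      ext ⟨p, u⟩
      simp only [G, Set.Finite.mem_toFinset, Set.mem_image, Set.mem_ofPred_eq]
      exact ⟨fun ⟨q, hq, h⟩ => h ▸ hq, fun h => ⟨_, h, rfl⟩⟩
    refine ⟨G, ⟨r, fun x w h₁ h₂ => ?_⟩, ?_⟩
    · rw [G.derives_iff, hG] at h₁ h₂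
      exact hr x w _ _ h₁ h₂
    · ext w
      rw [hL, ← derives_iff_yields, ← hG]
      exact G.derives_iff _ _

end Language

/-! ### Homomorphic images of languages of counter grammars -/

namespace WeightedIndexed

open Relation

variable {S T N I M : Type*} [AddCommMonoid M]

/-- The action of a substitution of terminals by words on a symbol. -/
def substSymbol (g : S → List T) : Symbol S N → List (Symbol T N)
  | .terminal a => (g a).map .terminal
  | .nonterminal A => [.nonterminal A]

/-- Substitute the terminals in the right-hand side of a production. -/
def substProduction (g : S → List T) : IndexedProduction S N I → IndexedProduction T N I
  | .expand A ν => .expand A (ν.flatMap (substSymbol g))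
  | .push A B f => .push A B f
  | .pop A f ν => .pop A f (ν.flatMap (substSymbol g))

/-- Substitute the terminals of a sentential form. -/
def substForm (g : S → List T) (x : IndexedForm S N I) : IndexedForm T N I :=
  x.flatMap (substSymbol g)

/-- The productions obtained by substituting the terminals. -/
def substProductions (g : S → List T) (P : Set (IndexedProduction S N I × M)) :
    Set (IndexedProduction T N I × M) :=
  (fun p => (substProduction g p.1, p.2)) '' P

variable {g : S → List T} {P : Set (IndexedProduction S N I × M)}

@[simp]
theorem substForm_append (x y : IndexedForm S N I) :
    substForm g (x ++ y) = substForm g x ++ substForm g y := by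
  simp [substForm]

theorem substForm_ofWord (w : List S) :
    substForm g (IndexedForm.ofWord N I w) = IndexedForm.ofWord N I (w.flatMap g) := by
  simp only [substForm, IndexedForm.ofWord, List.flatMap_map, List.map_flatMap]
  rfl

theorem substForm_attach (α : List I) (ν : List (Symbol S N)) :
    substForm g (IndexedForm.attach α ν) = IndexedForm.attach α (ν.flatMap (substSymbol g)) := by
  induction ν with
  | nil => rfl
  | cons s ν ih =>
    have hc : ∀ (s : Symbol S N) (ν), IndexedForm.attach α (s :: ν) =
        [IndexedForm.attachSymbol α s] ++ IndexedForm.attach α ν := fun _ _ => rfl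
    have ha : ∀ ν ν' : List (Symbol T N), IndexedForm.attach α (ν ++ ν') =
        IndexedForm.attach α ν ++ IndexedForm.attach α ν' := by
      simp [IndexedForm.attach]
    rw [hc, substForm_append, ih, List.flatMap_cons, ha]
    cases s with
    | terminal a =>
      simp [substForm, substSymbol, IndexedForm.attachSymbol, IndexedForm.attach]
    | nonterminal A => rfl

theorem numNonterminals_append (x y : IndexedForm T N I) :
    IndexedForm.numNonterminals (x ++ y) =
      IndexedForm.numNonterminals x + IndexedForm.numNonterminals y := by
  simp [IndexedForm.numNonterminals]

theorem numNonterminals_map_terminal (w : List T) :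
    IndexedForm.numNonterminals (w.map Symbol.terminal : IndexedForm T N I) = 0 := by
  simp [IndexedForm.numNonterminals, IndexedForm.isNonterminal]

theorem numNonterminals_substForm (x : IndexedForm S N I) :
    IndexedForm.numNonterminals (substForm g x) = IndexedForm.numNonterminals x := by
  induction x with
  | nil => rfl
  | cons s x ih =>
    rw [← List.singleton_append, substForm_append, numNonterminals_append,
      numNonterminals_append, ih]
    congr 1
    cases s with
    | terminal a =>
      simp only [substForm, substSymbol, List.flatMap_singleton]
      rw [numNonterminals_map_terminal]
      rfl
    | nonterminal A => rfl

theorem replaces_subst {p : IndexedProduction S N I} {A : N} {α : List I}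
    {β : IndexedForm T N I} :
    (substProduction g p).Replaces A α β ↔ ∃ β₀, p.Replaces A α β₀ ∧ β = substForm g β₀ := by
  constructor
  · intro h
    cases p with
    | expand B ν => cases h; exact ⟨_, .expand _ _ _, (substForm_attach _ _).symm⟩
    | push B C f => cases h; exact ⟨_, .push _ _ _ _, rfl⟩
    | pop B f ν => cases h; exact ⟨_, .pop _ _ _ _, (substForm_attach _ _).symm⟩
  · rintro ⟨β₀, h, rfl⟩
    cases h with
    | expand => rw [substForm_attach]; exact .expand _ _ _
    | push => exact .push _ _ _ _
    | pop => rw [substForm_attach]; exact .pop _ _ _ _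

/-- The substitution inserts terminals only, so an occurrence of a nonterminal in the image comes
from an occurrence in the source. -/
theorem exists_of_substForm_eq_append {x : IndexedForm S N I} {u v : IndexedForm T N I}
    {X : N × List I} (h : substForm g x = u ++ [.nonterminal X] ++ v) :
    ∃ u₀ v₀, x = u₀ ++ [.nonterminal X] ++ v₀ ∧ substForm g u₀ = u ∧ substForm g v₀ = v := by
  induction x generalizing u with
  | nil => simp [substForm] at h
  | cons s x ih =>
    cases s with
    | terminal a =>
      have h' : (g a).map Symbol.terminal ++ substForm g x = u ++ ([.nonterminal X] ++ v) := by
        simpa [substForm, substSymbol] using h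
      -- Either the image of `a` ends within `u`, or it reaches at least to the end of `u`.
      obtain ⟨c, rfl, hc⟩ | ⟨c, hc, hc'⟩ := List.append_eq_append_iff.1 h'
      · obtain ⟨u₀, v₀, rfl, rfl, rfl⟩ := ih (u := c) (by simpa using hc)
        exact ⟨.terminal a :: u₀, v₀, rfl, by simp [substForm, substSymbol], rfl⟩
      · cases c with
        | nil =>
          obtain ⟨u₀, v₀, rfl, hu, rfl⟩ := ih (u := []) (by simpa using hc'.symm)
          refine ⟨.terminal a :: u₀, v₀, rfl, ?_, rfl⟩
          simp only [List.append_nil] at hc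
          rw [← hc]
          simpa [substForm, substSymbol] using hu
        | cons t c =>
          -- An overlap is impossible: its first symbol `t` would be both a terminal from `g a` and
          -- the nonterminal `X`.
          simp only [List.cons_append, List.nil_append, List.cons.injEq] at hc'
          have : t ∈ (g a).map (Symbol.terminal (N := N × List I)) := by simp [hc]
          rw [← hc'.1] at this
          simp at this
    | nonterminal Y =>
      have h' : Symbol.nonterminal Y :: substForm g x = u ++ [.nonterminal X] ++ v := h
      cases u with
      | nil =>
        simp only [List.nil_append, List.cons_append, List.cons.injEq,
          Symbol.nonterminal.injEq] at h'
        exact ⟨[], x, by simp [h'.1], rfl, h'.2⟩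
      | cons t u =>
        simp only [List.cons_append, List.cons.injEq] at h'
        obtain ⟨u₀, v₀, rfl, rfl, rfl⟩ := ih (u := u) (by simpa using h'.2)
        exact ⟨.nonterminal Y :: u₀, v₀, rfl, by rw [← h'.1]; rfl, rfl⟩

theorem exists_of_substForm_eq_ofWord {x : IndexedForm S N I} {w : List T}
    (h : substForm g x = IndexedForm.ofWord N I w) :
    ∃ v, x = IndexedForm.ofWord N I v ∧ v.flatMap g = w := by
  have hx : ∃ v, x = IndexedForm.ofWord N I v := by
    have hn : IndexedForm.numNonterminals x = 0 := by
      rw [← numNonterminals_substForm (g := g), h]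
      exact numNonterminals_map_terminal w
    clear h
    induction x with
    | nil => exact ⟨[], rfl⟩
    | cons s x ih =>
      cases s with
      | terminal a =>
        obtain ⟨v, rfl⟩ := ih (by simpa [IndexedForm.numNonterminals,
          IndexedForm.isNonterminal] using hn)
        exact ⟨a :: v, rfl⟩
      | nonterminal X => simp [IndexedForm.numNonterminals, IndexedForm.isNonterminal] at hn
  obtain ⟨v, rfl⟩ := hx
  refine ⟨v, rfl, ?_⟩
  rw [substForm_ofWord] at h
  exact List.map_injective_iff.2 (fun a b hab => by simpa using hab) h

theorem Step.subst {x y : IndexedForm S N I × M} (h : Step P x y) :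
    Step (substProductions g P) (substForm g x.1, x.2) (substForm g y.1, y.2) := by
  obtain ⟨p, hp, ⟨u, v, A, α, β, hr, hx, hy⟩, hm⟩ := h
  refine ⟨_, ⟨p, hp, rfl⟩, ⟨substForm g u, substForm g v, A, α, substForm g β,
    replaces_subst.2 ⟨β, hr, rfl⟩, ?_, ?_⟩, hm⟩
  · simp only [hx, substForm_append]; rfl
  · simp only [hy, substForm_append]

/-- Substitution touches neither nonterminals nor stacks, so the same production applies at the
corresponding occurrence of any chosen preimage. -/
theorem Step.of_subst {x : IndexedForm S N I} {m : M} {z : IndexedForm T N I × M}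
    (h : Step (substProductions g P) (substForm g x, m) z) :
    ∃ y, z.1 = substForm g y ∧ Step P (x, m) (y, z.2) := by
  obtain ⟨_, ⟨p, hp, rfl⟩, ⟨u, v, A, α, β, hr, hx, hy⟩, hm⟩ := h
  obtain ⟨β₀, hβ, rfl⟩ := replaces_subst.1 hr
  obtain ⟨u₀, v₀, rfl, rfl, rfl⟩ := exists_of_substForm_eq_append hx
  exact ⟨u₀ ++ β₀ ++ v₀, by simp [hy], p, hp, ⟨u₀, v₀, A, α, β₀, hβ, rfl, rfl⟩, hm⟩

theorem Derives.of_subst {x : IndexedForm S N I} {m : M} {z : IndexedForm T N I × M}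
    (h : Derives (substProductions g P) (substForm g x, m) z) :
    ∃ y, z.1 = substForm g y ∧ Derives P (x, m) (y, z.2) := by
  induction h with
  | refl => exact ⟨x, rfl, .refl⟩
  | @tail b c _ hbc ih =>
    obtain ⟨y, hy, hd⟩ := ih
    obtain ⟨b₁, b₂⟩ := b
    simp only at hy hd
    subst hy
    obtain ⟨y', hy', hs⟩ := Step.of_subst hbc
    exact ⟨y', hy', hd.tail hs⟩

theorem yields_subst_iff {A : N} {w : List T} {n : M} :
    Yields (substProductions g P) [.nonterminal (A, [])] w n ↔
      ∃ v, Yields P [.nonterminal (A, [])] v n ∧ v.flatMap g = w := by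
  simp only [← derives_iff_yields]
  constructor
  · intro h
    obtain ⟨y, hy, hd⟩ := Derives.of_subst (x := [.nonterminal (A, [])]) h
    obtain ⟨v, rfl, rfl⟩ := exists_of_substForm_eq_ofWord hy.symm
    exact ⟨v, hd, rfl⟩
  · rintro ⟨v, h, rfl⟩
    rw [← substForm_ofWord]
    exact ReflTransGen.map_of_forall (fun z : IndexedForm S N I × M => (substForm g z.1, z.2))
      (fun _ _ hz => .single hz.subst) h

/-- `g` need not be injective, so there is no canonical map back to the original forms to which
`of_simulation` would apply. Instead the derivation is lifted step by step from the start form, and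
the form reached is lifted with it. -/
theorem IsIndex.subst {A : N} {r : ℕ} (h : IsIndex P A r) :
    IsIndex (substProductions g P) A r := by
  intro x w m m' h₁ h₂
  obtain ⟨y, hy, hd⟩ := Derives.of_subst (x := [.nonterminal (A, [])]) h₁
  simp only at hy hd
  subst hy
  obtain ⟨z, hz, hd'⟩ := Derives.of_subst h₂
  obtain ⟨v, rfl, -⟩ := exists_of_substForm_eq_ofWord hz.symm
  rw [numNonterminals_substForm]
  exact h y v m m' hd hd'

end WeightedIndexed

namespace Language

open WeightedIndexed

theorem freeMonoidHom_ofList {S T : Type*} (h : FreeMonoid S →* FreeMonoid T) (v : List S) :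
    h (FreeMonoid.ofList v) =
      FreeMonoid.ofList (v.flatMap fun a => FreeMonoid.toList (h (FreeMonoid.of a))) := by
  induction v with
  | nil => exact map_one h
  | cons a v ih =>
    rw [FreeMonoid.ofList_cons, map_mul, ih, List.flatMap_cons, FreeMonoid.ofList_append]
    rfl

theorem mem_homImage_iff {S T : Type*} (h : FreeMonoid S →* FreeMonoid T) (L : Language S)
    (w : List T) : w ∈ homImage h L ↔
      ∃ v ∈ L, (v.flatMap fun a => FreeMonoid.toList (h (FreeMonoid.of a))) = w := by
  simp only [homImage, freeMonoidHom_ofList]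
  rfl

theorem IsUFINc.homImage {S T : Type*} {L : Language S} (hL : L.IsUFINc)
    (h : FreeMonoid S →* FreeMonoid T) : (homImage h L).IsUFINc := by
  obtain ⟨k, N, I, _, _, A, P, r, hP, hr, hL⟩ := isUFINc_iff.1 hL
  refine isUFINc_iff.2 ⟨k, N, I, ‹_›, ‹_›, A,
    substProductions (fun a => FreeMonoid.toList (h (FreeMonoid.of a))) P, r, hP.image _,
    hr.subst, fun w => ?_⟩
  simp only [mem_homImage_iff, hL, yields_subst_iff]
  constructor
  · rintro ⟨v, ⟨n, hv, hn⟩, hw⟩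
    exact ⟨n, ⟨v, hv, hw⟩, hn⟩
  · rintro ⟨n, ⟨v, hv, hw⟩, hn⟩
    exact ⟨v, ⟨n, hv, hn⟩, hw⟩

end Language

/-! ### Recording the counters by letters -/

namespace WeightedIndexed

open Relation

variable {T R N I : Type*} {k : ℕ}

/-- A word over `Fin k` that contains the letter `i` exactly `c i` times. -/
def counterWord (c : Fin k → ℕ) : List (R ⊕ Fin k) :=
  (List.finRange k).flatMap fun i => List.replicate (c i) (Sum.inr i)

/-- The number of occurrences of the letters that stand for counters. -/
def counterCount (w : List (R ⊕ Fin k)) (i : Fin k) : ℕ :=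
  w.countP fun s => s.elim (fun _ => false) fun j => decide (j = i)

/-- The image of a letter under the homomorphism that erases the letters for the counters. -/
def eraseLetter (e : T ≃ R) : R ⊕ Fin k → List T :=
  Sum.elim (fun a => [e.symm a]) fun _ => []

/-- The nonterminals of the recording grammar: `(B, f)` stands for a pending push `B f`. -/
abbrev RecNT (N I : Type*) := N ⊕ (N × I)

/-- Rename the symbols of a right-hand side. -/
def recSymbol (e : T ≃ R) : Symbol T N → Symbol (R ⊕ Fin k) (RecNT N I)
  | .terminal a => .terminal (.inl (e a))
  | .nonterminal A => .nonterminal (.inl A)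

/-- The first step of the simulation of a production: write the letters for the counters. -/
def recProduction (e : T ≃ R) (c : Fin k → ℕ) :
    IndexedProduction T N I → IndexedProduction (R ⊕ Fin k) (RecNT N I) I
  | .expand A ν => .expand (.inl A) ((counterWord c).map .terminal ++ ν.map (recSymbol e))
  | .push A B f =>
      .expand (.inl A) ((counterWord c).map .terminal ++ [.nonterminal (.inr (B, f))])
  | .pop A f ν => .pop (.inl A) f ((counterWord c).map .terminal ++ ν.map (recSymbol e))

/-- The productions of the recording grammar. -/
def recProductions (e : T ≃ R) (P : Set (IndexedProduction T N I × (Fin k → ℕ))) :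
    Set (IndexedProduction (R ⊕ Fin k) (RecNT N I) I × Unit) :=
  (fun p => (recProduction e p.2 p.1, ())) '' P ∪
    Set.range fun q : N × I => (.push (.inr q) (.inl q.1) q.2, ())

/-- Forget the recorded counters in a symbol. -/
def unrecSymbol (e : T ≃ R) :
    Symbol (R ⊕ Fin k) (RecNT N I × List I) → IndexedForm T N I
  | .terminal s => (eraseLetter e s).map .terminal
  | .nonterminal (.inl A, α) => [.nonterminal (A, α)]
  | .nonterminal (.inr (B, f), α) => [.nonterminal (B, f :: α)]

/-- Forget the recorded counters in a sentential form. -/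
def unrecForm (e : T ≃ R) (x : IndexedForm (R ⊕ Fin k) (RecNT N I) I) : IndexedForm T N I :=
  x.flatMap (unrecSymbol e)

/-- The counters recorded in a sentential form. -/
def recCount (x : IndexedForm (R ⊕ Fin k) (RecNT N I) I) (i : Fin k) : ℕ :=
  x.countP fun
    | .terminal s => s.elim (fun _ => false) fun j => decide (j = i)
    | .nonterminal _ => false

variable {e : T ≃ R}

theorem counterCount_append (v w : List (R ⊕ Fin k)) :
    counterCount (v ++ w) = counterCount v + counterCount w := by
  ext i; simp [counterCount]

theorem counterCount_counterWord (c : Fin k → ℕ) :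
    counterCount (counterWord c : List (R ⊕ Fin k)) = c := by
  ext i
  simp only [counterCount, counterWord, List.countP_flatMap]
  have : ((List.countP fun s : R ⊕ Fin k => s.elim (fun _ => false) fun j => decide (j = i)) ∘
      fun j => List.replicate (c j) (Sum.inr j)) = fun j => if j = i then c j else 0 := by
    ext j
    simp [List.countP_replicate]
  rw [this, ← Fin.sum_univ_def]
  simp

theorem recCount_append (x y : IndexedForm (R ⊕ Fin k) (RecNT N I) I) :
    recCount (x ++ y) = recCount x + recCount y := by
  ext i; simp [recCount]

theorem recCount_map_terminal (w : List (R ⊕ Fin k)) :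
    recCount (w.map .terminal : IndexedForm (R ⊕ Fin k) (RecNT N I) I) = counterCount w := by
  ext i; simp only [recCount, counterCount, List.countP_map]; rfl

theorem unrecForm_append (x y : IndexedForm (R ⊕ Fin k) (RecNT N I) I) :
    unrecForm e (x ++ y) = unrecForm e x ++ unrecForm e y := by
  simp [unrecForm]

theorem unrecForm_ofWord (w : List (R ⊕ Fin k)) :
    unrecForm e (IndexedForm.ofWord (RecNT N I) I w) =
      IndexedForm.ofWord N I (w.flatMap (eraseLetter e)) := by
  simp only [unrecForm, IndexedForm.ofWord, List.flatMap_map, List.map_flatMap]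
  rfl

theorem flatMap_eraseLetter_counterWord (c : Fin k → ℕ) :
    (counterWord c).flatMap (eraseLetter e) = [] := by
  simp [counterWord, eraseLetter, List.flatMap_eq_nil_iff]

theorem unrecForm_counterWord (c : Fin k → ℕ) :
    unrecForm e ((counterWord c).map .terminal : IndexedForm (R ⊕ Fin k) (RecNT N I) I) = [] := by
  have := unrecForm_ofWord (N := N) (I := I) (e := e) (counterWord c)
  rwa [flatMap_eraseLetter_counterWord] at this

theorem unrecForm_rec (α : List I) (ν : List (Symbol T N)) :
    unrecForm e (IndexedForm.attach α (ν.map (recSymbol (k := k) e))) =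
      IndexedForm.attach α ν := by
  simp only [unrecForm, IndexedForm.attach, List.map_map, List.flatMap_map]
  rw [← List.flatMap_pure_eq_map]
  congr 1
  ext s
  cases s <;> simp [recSymbol, IndexedForm.attachSymbol, unrecSymbol, eraseLetter]

theorem recCount_rec (α : List I) (ν : List (Symbol T N)) :
    recCount (IndexedForm.attach α (ν.map (recSymbol (k := k) e))) = 0 := by
  ext i
  simp only [recCount, Pi.zero_apply, List.countP_eq_zero, IndexedForm.attach, List.mem_map]
  rintro _ ⟨_, ⟨s, -, rfl⟩, rfl⟩
  cases s <;> simp [recSymbol, IndexedForm.attachSymbol]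

theorem attach_append (α : List I) (ν ν' : List (Symbol T N)) :
    IndexedForm.attach α (ν ++ ν') = IndexedForm.attach α ν ++ IndexedForm.attach α ν' := by
  simp [IndexedForm.attach]

theorem attach_map_terminal (α : List I) (w : List T) :
    IndexedForm.attach α (w.map .terminal : List (Symbol T N)) = w.map .terminal := by
  simp only [IndexedForm.attach, List.map_map]
  rfl

theorem numNonterminals_unrecForm (x : IndexedForm (R ⊕ Fin k) (RecNT N I) I) :
    IndexedForm.numNonterminals (unrecForm e x) = IndexedForm.numNonterminals x := by
  induction x with
  | nil => rfl
  | cons s x ih =>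
    rw [← List.singleton_append, unrecForm_append, numNonterminals_append,
      numNonterminals_append, ih]
    congr 1
    rcases s with (a | a) | ⟨A | ⟨B, f⟩, α⟩ <;> rfl

variable {P : Set (IndexedProduction T N I × (Fin k → ℕ))}

/-- A pending push `(B, f)` is read as `B` with `f` already on its stack. Thus writing the counter
letters corresponds to the original step, and the delayed push corresponds to no step. -/
theorem Step.unrec {x y : IndexedForm (R ⊕ Fin k) (RecNT N I) I × Unit}
    (h : Step (recProductions e P) x y) :
    Derives P (unrecForm e x.1, recCount x.1) (unrecForm e y.1, recCount y.1) := by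
  obtain ⟨x, ux⟩ := x
  obtain ⟨y, uy⟩ := y
  obtain ⟨p, hp, ⟨u, v, A, α, β, hr, hx, hy⟩, -⟩ := h
  simp only at hx hy ⊢
  subst hx hy
  simp only [unrecForm_append, recCount_append]
  suffices h : Derives P (unrecForm e [.nonterminal (A, α)], 0)
      (unrecForm e β, recCount β) by
    have := h.context (unrecForm e u) (unrecForm e v) (recCount u + recCount v)
    convert this using 2
    · have : recCount ([.nonterminal (A, α)] : IndexedForm (R ⊕ Fin k) (RecNT N I) I) = 0 := rfl
      rw [this]; abel
    · abel
  rcases hp with ⟨⟨q, c⟩, hq, rfl⟩ | ⟨⟨B, f⟩, rfl⟩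
  · cases q with
    | expand B ν =>
      cases hr
      refine ReflTransGen.single ⟨_, hq, ⟨[], [], B, α, _, .expand _ _ _, rfl, ?_⟩, ?_⟩
      · simp [attach_append, attach_map_terminal, unrecForm_append, unrecForm_counterWord,
          unrecForm_rec]
      · simp [attach_append, attach_map_terminal, recCount_append, recCount_map_terminal,
          counterCount_counterWord, recCount_rec]
    | push B C f =>
      cases hr
      refine ReflTransGen.single ⟨_, hq, ⟨[], [], B, α, _, .push _ _ _ _, rfl, ?_⟩, ?_⟩
      · simp only [attach_append, attach_map_terminal, unrecForm_append, unrecForm_counterWord]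
        rfl
      · simp only [attach_append, attach_map_terminal, recCount_append, recCount_map_terminal,
          counterCount_counterWord, zero_add]
        rfl
    | pop B f ν =>
      cases hr
      refine ReflTransGen.single ⟨_, hq, ⟨[], [], B, _, _, .pop _ _ _ _, rfl, ?_⟩, ?_⟩
      · simp [attach_append, attach_map_terminal, unrecForm_append, unrecForm_counterWord,
          unrecForm_rec]
      · simp [attach_append, attach_map_terminal, recCount_append, recCount_map_terminal,
          counterCount_counterWord, recCount_rec]
  · cases hr
    exact .refl

/-- Embed sentential forms into those of the recording grammar. -/
def recForm (e : T ≃ R) (x : IndexedForm T N I) : IndexedForm (R ⊕ Fin k) (RecNT N I) I :=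
  x.map fun
    | .terminal a => .terminal (.inl (e a))
    | .nonterminal (A, α) => .nonterminal (.inl A, α)

theorem recForm_attach (α : List I) (ν : List (Symbol T N)) :
    recForm (k := k) e (IndexedForm.attach α ν) =
      IndexedForm.attach α (ν.map (recSymbol e)) := by
  simp only [recForm, IndexedForm.attach, List.map_map]
  congr 1
  ext s
  cases s <;> rfl

theorem yields_map_terminal_append {S M : Type*} [AddCommMonoid M]
    {P : Set (IndexedProduction S N I × M)} (v : List S) {x : IndexedForm S N I} {w : List S}
    {n : M} (h : Yields P x w n) : Yields P (v.map .terminal ++ x) (v ++ w) n := by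
  simpa [IndexedForm.ofWord] using (Yields.ofWord v).append h

/-- Each node of the tree is replaced by one that first writes the counter letters; a push becomes
two nodes, since a push production cannot write terminals. -/
theorem Yields.exists_rec {x : IndexedForm T N I} {w : List T} {n : Fin k → ℕ}
    (h : Yields P x w n) : ∃ v, Yields (recProductions e P) (recForm e x) v () ∧
      v.flatMap (eraseLetter e) = w ∧ counterCount v = n := by
  induction h with
  | nil => exact ⟨[], .nil, rfl, rfl⟩
  | @terminal a x w n h ih =>
    obtain ⟨v, hv, rfl, rfl⟩ := ih
    refine ⟨.inl (e a) :: v, .terminal hv, by simp [eraseLetter], ?_⟩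
    ext i
    simp [counterCount]
  | @nonterminal p A α β x w₁ w₂ n₁ n₂ hp hr h₁ h₂ ih₁ ih₂ =>
    obtain ⟨v₁, hv₁, rfl, rfl⟩ := ih₁
    obtain ⟨v₂, hv₂, rfl, rfl⟩ := ih₂
    obtain ⟨p, c⟩ := p
    refine ⟨(counterWord c ++ v₁) ++ v₂, ?_, by simp [flatMap_eraseLetter_counterWord],
      by simp [counterCount_append, counterCount_counterWord, add_assoc]⟩
    have hp' : (recProduction e c p, ()) ∈ recProductions e P := .inl ⟨_, hp, rfl⟩
    cases hr with
    | expand A ν α =>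
      refine Yields.nonterminal (n₁ := ()) (n₂ := ()) hp' (.expand _ _ _) ?_ hv₂
      rw [attach_append, attach_map_terminal, ← recForm_attach]
      exact yields_map_terminal_append _ hv₁
    | push A B f α =>
      refine Yields.nonterminal (n₁ := ()) (n₂ := ()) hp' (.expand _ _ _) ?_ hv₂
      rw [attach_append, attach_map_terminal]
      refine yields_map_terminal_append _ ?_
      have hq : (.push (.inr (B, f)) (.inl B) f, ()) ∈ recProductions e P := .inr ⟨(B, f), rfl⟩
      have := Yields.nonterminal (n₁ := ()) (n₂ := ()) hq (.push _ _ _ α) hv₁ .nil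
      rwa [List.append_nil] at this
    | pop A f ν α =>
      refine Yields.nonterminal (n₁ := ()) (n₂ := ()) hp' (.pop _ _ _ _) ?_ hv₂
      rw [attach_append, attach_map_terminal, ← recForm_attach]
      exact yields_map_terminal_append _ hv₁

theorem IsIndex.recording {A : N} {r : ℕ} (h : IsIndex P A r) :
    IsIndex (recProductions e P) (.inl A) r :=
  h.of_simulation (unrecForm e) (fun z => recCount z.1) (fun _ _ => Step.unrec) rfl rfl
    (fun x => (numNonterminals_unrecForm x).ge) fun w => ⟨_, unrecForm_ofWord w⟩

theorem yields_iff_exists_rec {A : N} {w : List T} {n : Fin k → ℕ} :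
    Yields P [.nonterminal (A, [])] w n ↔
      ∃ v, Yields (recProductions e P) [.nonterminal (.inl A, [])] v () ∧
        v.flatMap (eraseLetter e) = w ∧ counterCount v = n := by
  refine ⟨fun h => h.exists_rec, ?_⟩
  rintro ⟨v, hv, rfl, rfl⟩
  have h := ReflTransGen.map_of_forall
    (fun z : IndexedForm (R ⊕ Fin k) (RecNT N I) I × Unit => (unrecForm e z.1, recCount z.1))
    (fun _ _ => Step.unrec) (derives_iff_yields.2 hv)
  rw [← derives_iff_yields, ← unrecForm_ofWord, ← recCount_map_terminal (N := N) (I := I)]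
  exact h

end WeightedIndexed

namespace Language

open WeightedIndexed

/-- The words in which all letters of `Fin k` occur equally often. -/
def equalCounts (R : Type*) (k : ℕ) : Language (R ⊕ Fin k) :=
  {v | ∀ i j, counterCount v i = counterCount v j}

/-- The terminals are renamed by `Fin n` because `T` may live in any universe, whereas the alphabet
of the intersection has to be in `Type`. -/
theorem IsUFINc.exists_homImage {T : Type*} [Finite T] {L : Language T} (hL : L.IsUFINc) :
    ∃ (n k : ℕ) (h : FreeMonoid (Fin n ⊕ Fin k) →* FreeMonoid T) (L₁ : Language (Fin n ⊕ Fin k)),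
      L₁.IsUFIN ∧ L = Language.homImage h (L₁ ⊓ equalCounts (Fin n) k) := by
  obtain ⟨n, ⟨e⟩⟩ := Finite.exists_equiv_fin T
  obtain ⟨k, N, I, _, _, A, P, r, hP, hr, hL⟩ := isUFINc_iff.1 hL
  refine ⟨n, k, FreeMonoid.lift fun s => FreeMonoid.ofList (eraseLetter e s),
    {v | Yields (recProductions e P) [.nonterminal (.inl A, [])] v ()},
    isUFIN_iff.2 ⟨RecNT N I, I, inferInstance, ‹_›, .inl A, recProductions e P, r,
      (hP.image _).union (Set.finite_range _), hr.recording, fun w => Iff.rfl⟩, ?_⟩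
  ext w
  rw [hL, mem_homImage_iff]
  simp only [yields_iff_exists_rec (e := e), FreeMonoid.lift_eval_of, FreeMonoid.toList_ofList]
  constructor
  · rintro ⟨_, ⟨v, hv, hw, rfl⟩, hn⟩
    exact ⟨v, ⟨hv, hn⟩, hw⟩
  · rintro ⟨v, ⟨hv, hn⟩, hw⟩
    exact ⟨_, ⟨v, hv, hw, rfl⟩, hn⟩

end Language

/-! ### Finite automata with weights, and their product with an indexed grammar -/

/-- Runs of a nondeterministic automaton with transitions `δ`, which may read no input and carry
weights: `WeightedRun δ p w q n` if the automaton can go from `p` to `q` reading `w` with total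
weight `n`. -/
inductive WeightedRun {S Q M : Type*} [AddCommMonoid M] (δ : Set (Q × Option S × M × Q)) :
    Q → List S → Q → M → Prop
  | nil (q : Q) : WeightedRun δ q [] q 0
  | eps {p r q : Q} {w : List S} {m n : M} (ht : (p, none, m, r) ∈ δ)
      (h : WeightedRun δ r w q n) : WeightedRun δ p w q (m + n)
  | read {p r q : Q} {a : S} {w : List S} {m n : M} (ht : (p, some a, m, r) ∈ δ)
      (h : WeightedRun δ r w q n) : WeightedRun δ p (a :: w) q (m + n)

namespace WeightedRun

variable {S Q M : Type*} [AddCommMonoid M] {δ : Set (Q × Option S × M × Q)}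

theorem append {p r q : Q} {v w : List S} {m n : M} (h : WeightedRun δ p v r m)
    (h' : WeightedRun δ r w q n) : WeightedRun δ p (v ++ w) q (m + n) := by
  induction h with
  | nil => simpa using h'
  | eps ht _ ih => rw [add_assoc]; exact .eps ht (ih h')
  | read ht _ ih => rw [add_assoc]; exact .read ht (ih h')

theorem of_append {p q : Q} {v w : List S} {n : M} (h : WeightedRun δ p (v ++ w) q n) :
    ∃ r n₁ n₂, n = n₁ + n₂ ∧ WeightedRun δ p v r n₁ ∧ WeightedRun δ r w q n₂ := by
  generalize hu : v ++ w = u at h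
  induction h generalizing v with
  | nil q =>
    obtain ⟨rfl, rfl⟩ := List.append_eq_nil_iff.1 hu
    exact ⟨q, 0, 0, by simp, .nil q, .nil q⟩
  | eps ht _ ih =>
    obtain ⟨r, n₁, n₂, rfl, h₁, h₂⟩ := ih hu
    exact ⟨r, _, n₂, (add_assoc _ _ _).symm, .eps ht h₁, h₂⟩
  | @read p r q a u m n ht h ih =>
    cases v with
    | nil =>
      simp only [List.nil_append] at hu
      subst hu
      exact ⟨p, 0, m + n, by simp, .nil p, .read ht h⟩
    | cons b v =>
      simp only [List.cons_append, List.cons.injEq] at hu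
      obtain ⟨rfl, hu⟩ := hu
      obtain ⟨r, n₁, n₂, rfl, h₁, h₂⟩ := ih hu
      exact ⟨r, _, n₂, (add_assoc _ _ _).symm, .read ht h₁, h₂⟩

end WeightedRun

namespace WeightedIndexed

open Relation

variable {S N I Q M : Type*}

/-- The right-hand side of a production that is not a push. -/
def rhs? : IndexedProduction S N I → Option (List (Symbol S N))
  | .expand _ ν => some ν
  | .push _ _ _ => none
  | .pop _ _ ν => some ν

/-- Forget the states of an annotated symbol. -/
def eraseStates : Symbol S (Q × N × Q) → Symbol S N
  | .terminal a => .terminal a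
  | .nonterminal X => .nonterminal X.2.1

/-- A stage in the scan of the right-hand side of a production by an automaton: the part `done`
has been scanned, and the automaton is to go from `src` to `tgt` on the part `todo`. -/
structure Stage (P : Set (IndexedProduction S N I × Unit)) (Q : Type*) where
  prod : IndexedProduction S N I
  done : List (Symbol S (Q × N × Q))
  src : Q
  todo : List (Symbol S N)
  tgt : Q
  mem : (prod, ()) ∈ P
  rhs : rhs? prod = some (done.map eraseStates ++ todo)

/-- The nonterminals of the product of an indexed grammar with an automaton. -/
inductive ProductNT (P : Set (IndexedProduction S N I × Unit)) (Q : Type*)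
  | init
  | tri (X : Q × N × Q)
  | stage (x : Stage P Q)

variable {P : Set (IndexedProduction S N I × Unit)}

/-- An annotated symbol as a symbol of the product grammar. -/
def triSymbol : Symbol S (Q × N × Q) → Symbol S (ProductNT P Q)
  | .terminal a => .terminal a
  | .nonterminal X => .nonterminal (.tri X)

/-- The productions of the product of an indexed grammar with an automaton. -/
inductive ProductRule [AddCommMonoid M] (P : Set (IndexedProduction S N I × Unit))
    (δ : Set (Q × Option S × M × Q)) (A₀ : N) (st ac : Set Q) :
    IndexedProduction S (ProductNT P Q) I × M → Prop
  | init {p q : Q} (hp : p ∈ st) (hq : q ∈ ac) :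
      ProductRule P δ A₀ st ac (.expand .init [.nonterminal (.tri (p, A₀, q))], 0)
  | push {A B : N} {f : I} {p q : Q} (h : (.push A B f, ()) ∈ P) :
      ProductRule P δ A₀ st ac (.push (.tri (p, A, q)) (.tri (p, B, q)) f, 0)
  | expand {A : N} {ν : List (Symbol S N)} {p q : Q} (h : (.expand A ν, ()) ∈ P) :
      ProductRule P δ A₀ st ac (.expand (.tri (p, A, q))
        [.nonterminal (.stage ⟨.expand A ν, [], p, ν, q, h, rfl⟩)], 0)
  | pop {A : N} {f : I} {ν : List (Symbol S N)} {p q : Q} (h : (.pop A f ν, ()) ∈ P) :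
      ProductRule P δ A₀ st ac (.pop (.tri (p, A, q)) f
        [.nonterminal (.stage ⟨.pop A f ν, [], p, ν, q, h, rfl⟩)], 0)
  | eps {π : IndexedProduction S N I} {ν' : List (Symbol S (Q × N × Q))} {p r q : Q}
      {ν : List (Symbol S N)} {m : M} (ht : (p, none, m, r) ∈ δ) (h h₁ h₂) :
      ProductRule P δ A₀ st ac (.expand (.stage ⟨π, ν', p, ν, q, h, h₁⟩)
        [.nonterminal (.stage ⟨π, ν', r, ν, q, h, h₂⟩)], m)
  | read {π : IndexedProduction S N I} {ν' : List (Symbol S (Q × N × Q))} {p r q : Q} {a : S}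
      {ν : List (Symbol S N)} {m : M} (ht : (p, some a, m, r) ∈ δ) (h h₁ h₂) :
      ProductRule P δ A₀ st ac (.expand (.stage ⟨π, ν', p, .terminal a :: ν, q, h, h₁⟩)
        [.nonterminal (.stage ⟨π, ν' ++ [.terminal a], r, ν, q, h, h₂⟩)], m)
  | jump {π : IndexedProduction S N I} {ν' : List (Symbol S (Q × N × Q))} {p r q : Q} {A : N}
      {ν : List (Symbol S N)} (h h₁ h₂) :
      ProductRule P δ A₀ st ac (.expand (.stage ⟨π, ν', p, .nonterminal A :: ν, q, h, h₁⟩)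
        [.nonterminal (.stage ⟨π, ν' ++ [.nonterminal (p, A, r)], r, ν, q, h, h₂⟩)], 0)
  | release {π : IndexedProduction S N I} {ν' : List (Symbol S (Q × N × Q))} {q : Q} (h h₁) :
      ProductRule P δ A₀ st ac (.expand (.stage ⟨π, ν', q, [], q, h, h₁⟩) (ν'.map triSymbol), 0)

/-- The set of productions of the product of an indexed grammar with an automaton. -/
def productRules [AddCommMonoid M] (P : Set (IndexedProduction S N I × Unit))
    (δ : Set (Q × Option S × M × Q)) (A₀ : N) (st ac : Set Q) :
    Set (IndexedProduction S (ProductNT P Q) I × M) :=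
  {p | ProductRule P δ A₀ st ac p}

/-- A stage is determined by its data, and `done` and `todo` together are as long as some right-hand
side from the finite set `P`. -/
theorem finite_stage [Finite S] [Finite N] [Finite Q] (hP : P.Finite) : Finite (Stage P Q) := by
  obtain ⟨K, hK⟩ : ∃ K, ∀ p ∈ P, ∀ ν, rhs? p.1 = some ν → ν.length ≤ K := by
    -- The sum of the lengths is a crude bound for their maximum.
    refine ⟨∑ p ∈ hP.toFinset, ((rhs? p.1).elim 0 List.length), fun p hp ν hν => ?_⟩
    have := Finset.single_le_sum (f := fun p : IndexedProduction S N I × Unit =>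
      ((rhs? p.1).elim 0 List.length)) (fun _ _ => Nat.zero_le _) (hP.mem_toFinset.2 hp)
    simpa [hν] using this
  have := hP.to_subtype
  have : Finite (Symbol S N) := by classical
    have := Fintype.ofFinite S
    have := Fintype.ofFinite N
    infer_instance
  have : Finite (Symbol S (Q × N × Q)) := by classical
    have := Fintype.ofFinite S
    have := Fintype.ofFinite (Q × N × Q)
    infer_instance
  have h₁ : Finite {l : List (Symbol S N) // l.length ≤ K} :=
    (List.finite_length_le (Symbol S N) K).to_subtype
  have h₂ : Finite {l : List (Symbol S (Q × N × Q)) // l.length ≤ K} :=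
    (List.finite_length_le (Symbol S (Q × N × Q)) K).to_subtype
  let F : Stage P Q → P × {l : List (Symbol S (Q × N × Q)) // l.length ≤ K} × Q ×
      {l : List (Symbol S N) // l.length ≤ K} × Q := fun x =>
    ⟨⟨(x.prod, ()), x.mem⟩,
      ⟨x.done, by have := hK _ x.mem _ x.rhs; simp at this; omega⟩, x.src,
      ⟨x.todo, by have := hK _ x.mem _ x.rhs; simp at this; omega⟩, x.tgt⟩
  refine Finite.of_injective F fun x y hxy => ?_
  obtain ⟨π, ν', p, ν, q, h, h'⟩ := x
  obtain ⟨π₂, ν'₂, p₂, ν₂, q₂, h₂, h₂'⟩ := y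
  simp only [F, Prod.mk.injEq, Subtype.mk.injEq] at hxy
  obtain ⟨⟨rfl, -⟩, rfl, rfl, rfl, rfl⟩ := hxy
  rfl

theorem finite_productNT [Finite S] [Finite N] [Finite Q] (hP : P.Finite) :
    Finite (ProductNT P Q) := by
  have := finite_stage (Q := Q) hP
  let F : ProductNT P Q → Option ((Q × N × Q) ⊕ Stage P Q)
    | .init => none
    | .tri X => some (.inl X)
    | .stage x => some (.inr x)
  refine Finite.of_injective F fun x y hxy => ?_
  cases x <;> cases y <;> simp_all [F]

/-- Only `0` and the weights in `δ` occur. Apart from pushes and releases, every rule has a single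
nonterminal on the right; a release is determined by its stage. -/
theorem finite_productRules [AddCommMonoid M] [Finite S] [Finite N] [Finite Q] [Finite I]
    (hP : P.Finite) {δ : Set (Q × Option S × M × Q)} (hδ : δ.Finite) (A₀ : N) (st ac : Set Q) :
    (productRules P δ A₀ st ac).Finite := by
  have := finite_stage (Q := Q) hP
  have := finite_productNT (Q := Q) hP
  let V : Set M := insert 0 ((fun t => t.2.2.1) '' δ)
  have hV : V.Finite := (hδ.image _).insert 0
  let R₁ : Set (IndexedProduction S (ProductNT P Q) I × M) :=
    (fun x : (ProductNT P Q × ProductNT P Q) × M => (.expand x.1.1 [.nonterminal x.1.2], x.2)) ''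
      Set.univ ×ˢ V
  let R₂ : Set (IndexedProduction S (ProductNT P Q) I × M) :=
    Set.range fun x : ProductNT P Q × ProductNT P Q × I => (.push x.1 x.2.1 x.2.2, 0)
  let R₃ : Set (IndexedProduction S (ProductNT P Q) I × M) :=
    Set.range fun x : ProductNT P Q × ProductNT P Q × I => (.pop x.1 x.2.2 [.nonterminal x.2.1], 0)
  let R₄ : Set (IndexedProduction S (ProductNT P Q) I × M) :=
    Set.range fun x : Stage P Q => (.expand (.stage x) (x.done.map triSymbol), 0)
  have hR : (R₁ ∪ R₂ ∪ R₃ ∪ R₄).Finite :=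
    (((Set.finite_univ.prod hV).image _).union (Set.finite_range _)).union (Set.finite_range _)
      |>.union (Set.finite_range _)
  refine hR.subset fun p hp => ?_
  have h0 : (0 : M) ∈ V := Set.mem_insert _ _
  have h1 : ∀ {p o m r}, (p, o, m, r) ∈ δ → m ∈ V := fun h => Set.mem_insert_of_mem _ ⟨_, h, rfl⟩
  cases hp with
  | init => exact .inl (.inl (.inl ⟨((_, _), 0), ⟨trivial, h0⟩, rfl⟩))
  | push => exact .inl (.inl (.inr ⟨(_, _, _), rfl⟩))
  | expand => exact .inl (.inl (.inl ⟨((_, _), 0), ⟨trivial, h0⟩, rfl⟩))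
  | pop => exact .inl (.inr ⟨(_, _, _), rfl⟩)
  | eps ht => exact .inl (.inl (.inl ⟨((_, _), _), ⟨trivial, h1 ht⟩, rfl⟩))
  | read ht => exact .inl (.inl (.inl ⟨((_, _), _), ⟨trivial, h1 ht⟩, rfl⟩))
  | jump => exact .inl (.inl (.inl ⟨((_, _), 0), ⟨trivial, h0⟩, rfl⟩))
  | release => exact .inr ⟨_, rfl⟩

/-! #### The index of the product -/

/-- The nonterminal and stack to which a production was applied. -/
def origin : IndexedProduction S N I → List I → N × List I
  | .expand A _, α => (A, α)
  | .push A _ _, α => (A, α)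
  | .pop A f _, α => (A, f :: α)

/-- The symbol of the original grammar simulated by a symbol of the product grammar. -/
def unproductSymbol (A₀ : N) :
    Symbol S (ProductNT P Q × List I) → Symbol S (N × List I)
  | .terminal a => .terminal a
  | .nonterminal (.init, α) => .nonterminal (A₀, α)
  | .nonterminal (.tri X, α) => .nonterminal (X.2.1, α)
  | .nonterminal (.stage x, α) => .nonterminal (origin x.prod α)

/-- The sentential form of the original grammar simulated by one of the product grammar. -/
def unproductForm (A₀ : N) (x : IndexedForm S (ProductNT P Q) I) : IndexedForm S N I :=
  x.map (unproductSymbol A₀)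

theorem unproductForm_attach (A₀ : N) (α : List I) (ν : List (Symbol S (Q × N × Q))) :
    unproductForm (P := P) A₀ (IndexedForm.attach α (ν.map triSymbol)) =
      IndexedForm.attach α (ν.map eraseStates) := by
  simp only [unproductForm, IndexedForm.attach, List.map_map]
  congr 1
  ext s
  cases s <;> rfl

theorem replaces_origin {π : IndexedProduction S N I} {ν : List (Symbol S N)}
    (h : rhs? π = some ν) (α : List I) :
    π.Replaces (origin π α).1 (origin π α).2 (IndexedForm.attach α ν) := by
  cases π with
  | expand A ν' => cases h; exact .expand _ _ _
  | push => cases h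
  | pop A f ν' => cases h; exact .pop _ _ _ _

variable [AddCommMonoid M] {δ : Set (Q × Option S × M × Q)} {A₀ : N} {st ac : Set Q}

/-- Until its release, a stage stands for the nonterminal and stack to which its production was
applied, with the popped index put back. Hence only a push or a release is a step of the original
grammar; all other rules leave the simulated form unchanged. -/
theorem Step.unproduct {x y : IndexedForm S (ProductNT P Q) I × M}
    (h : Step (productRules P δ A₀ st ac) x y) :
    Derives P (unproductForm A₀ x.1, ()) (unproductForm A₀ y.1, ()) := by
  obtain ⟨p, hp, ⟨u, v, A, α, β, hr, hx, hy⟩, -⟩ := h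
  rw [hx, hy]
  suffices h : Derives P (unproductForm A₀ [.nonterminal (A, α)], ()) (unproductForm A₀ β, ()) by
    have := h.context (unproductForm A₀ u) (unproductForm A₀ v) ()
    simpa [unproductForm] using this
  cases hp with
  | push h =>
    cases hr
    exact .single ⟨_, h, ⟨[], [], _, _, _, .push _ _ _ _, rfl, rfl⟩, rfl⟩
  | release h h₁ =>
    cases hr
    rw [unproductForm_attach]
    refine .single ⟨_, h, ⟨[], [], _, _, _, replaces_origin h₁ α, rfl, ?_⟩, rfl⟩
    simp
  | _ => cases hr; exact .refl

theorem numNonterminals_unproductForm (x : IndexedForm S (ProductNT P Q) I) :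
    IndexedForm.numNonterminals (unproductForm A₀ x) = IndexedForm.numNonterminals x := by
  simp only [IndexedForm.numNonterminals, unproductForm, List.countP_map]
  congr 1
  ext s
  rcases s with a | ⟨_ | _ | _, α⟩ <;> rfl

theorem unproductForm_ofWord (w : List S) :
    unproductForm A₀ (IndexedForm.ofWord (ProductNT P Q) I w) = IndexedForm.ofWord N I w := by
  simp only [unproductForm, IndexedForm.ofWord, List.map_map]
  rfl

theorem IsIndex.product {r : ℕ} (h : IsIndex P A₀ r) :
    IsIndex (productRules P δ A₀ st ac) .init r :=
  h.of_simulation (unproductForm A₀) (fun _ => ()) (fun _ _ => Step.unproduct) rfl rfl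
    (fun x => (numNonterminals_unproductForm x).ge) fun w => ⟨w, unproductForm_ofWord w⟩

/-! #### The language of the product -/

/-- What a sentential form of the product grammar is meant to yield. -/
inductive ProductSem (P : Set (IndexedProduction S N I × Unit))
    (δ : Set (Q × Option S × M × Q)) (A₀ : N) (st ac : Set Q) :
    IndexedForm S (ProductNT P Q) I → List S → M → Prop
  | nil : ProductSem P δ A₀ st ac [] [] 0
  | terminal {a : S} {x : IndexedForm S (ProductNT P Q) I} {w : List S} {n : M}
      (h : ProductSem P δ A₀ st ac x w n) :
      ProductSem P δ A₀ st ac (.terminal a :: x) (a :: w) n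
  | init {p q : Q} {α : List I} {x : IndexedForm S (ProductNT P Q) I} {w₁ w₂ : List S} {n₁ n₂ : M}
      (hp : p ∈ st) (hq : q ∈ ac) (h₁ : Yields P [.nonterminal (A₀, α)] w₁ ())
      (hr : WeightedRun δ p w₁ q n₁) (h : ProductSem P δ A₀ st ac x w₂ n₂) :
      ProductSem P δ A₀ st ac (.nonterminal (.init, α) :: x) (w₁ ++ w₂) (n₁ + n₂)
  | tri {A : N} {p q : Q} {α : List I} {x : IndexedForm S (ProductNT P Q) I} {w₁ w₂ : List S}
      {n₁ n₂ : M} (h₁ : Yields P [.nonterminal (A, α)] w₁ ())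
      (hr : WeightedRun δ p w₁ q n₁) (h : ProductSem P δ A₀ st ac x w₂ n₂) :
      ProductSem P δ A₀ st ac (.nonterminal (.tri (p, A, q), α) :: x) (w₁ ++ w₂) (n₁ + n₂)
  | stage {y : Stage P Q} {α : List I} {x : IndexedForm S (ProductNT P Q) I}
      {w₀ w₁ w₂ : List S} {n₀ n₁ n₂ : M}
      (h₀ : ProductSem P δ A₀ st ac (IndexedForm.attach α (y.done.map triSymbol)) w₀ n₀)
      (h₁ : Yields P (IndexedForm.attach α y.todo) w₁ ())
      (hr : WeightedRun δ y.src w₁ y.tgt n₁) (h : ProductSem P δ A₀ st ac x w₂ n₂) :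
      ProductSem P δ A₀ st ac (.nonterminal (.stage y, α) :: x) (w₀ ++ w₁ ++ w₂) (n₀ + n₁ + n₂)

theorem ProductSem.of_append {x y : IndexedForm S (ProductNT P Q) I} {w : List S} {n : M}
    (h : ProductSem P δ A₀ st ac (x ++ y) w n) :
    ∃ w₁ w₂ n₁ n₂, w = w₁ ++ w₂ ∧ n = n₁ + n₂ ∧ ProductSem P δ A₀ st ac x w₁ n₁ ∧
      ProductSem P δ A₀ st ac y w₂ n₂ := by
  induction x generalizing w n with
  | nil => exact ⟨[], w, 0, n, rfl, by simp, .nil, h⟩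
  | cons s x ih =>
    cases h with
    | terminal h =>
      obtain ⟨w₁, w₂, n₁, n₂, rfl, rfl, h₁, h₂⟩ := ih h
      exact ⟨_, w₂, n₁, n₂, rfl, rfl, .terminal h₁, h₂⟩
    | init hp hq h₁ hr h =>
      obtain ⟨w₁, w₂, n₁, n₂, rfl, rfl, h₃, h₄⟩ := ih h
      exact ⟨_, w₂, _, n₂, (List.append_assoc _ _ _).symm, (add_assoc _ _ _).symm,
        .init hp hq h₁ hr h₃, h₄⟩
    | tri h₁ hr h =>
      obtain ⟨w₁, w₂, n₁, n₂, rfl, rfl, h₃, h₄⟩ := ih h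
      exact ⟨_, w₂, _, n₂, (List.append_assoc _ _ _).symm, (add_assoc _ _ _).symm,
        .tri h₁ hr h₃, h₄⟩
    | stage h₀ h₁ hr h =>
      obtain ⟨w₁, w₂, n₁, n₂, rfl, rfl, h₃, h₄⟩ := ih h
      exact ⟨_, w₂, _, n₂, (List.append_assoc _ _ _).symm, (add_assoc _ _ _).symm,
        .stage h₀ h₁ hr h₃, h₄⟩

theorem Yields.singleton {p : IndexedProduction S N I × M} {R : Set (IndexedProduction S N I × M)}
    {A : N} {α : List I} {β : IndexedForm S N I} {w : List S} {n : M} (hp : p ∈ R)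
    (hr : p.1.Replaces A α β) (h : Yields R β w n) :
    Yields R [.nonterminal (A, α)] w (p.2 + n) := by
  simpa using Yields.nonterminal hp hr h .nil

theorem ProductSem.nil_inv {w : List S} {n : M} (h : ProductSem P δ A₀ st ac [] w n) :
    w = [] ∧ n = 0 := by
  cases h; exact ⟨rfl, rfl⟩

theorem ProductSem.tri_inv {A : N} {p q : Q} {α : List I} {w : List S} {n : M}
    (h : ProductSem P δ A₀ st ac [.nonterminal (.tri (p, A, q), α)] w n) :
    Yields P [.nonterminal (A, α)] w () ∧ WeightedRun δ p w q n := by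
  cases h with
  | tri h₁ hr h =>
    obtain ⟨rfl, rfl⟩ := h.nil_inv
    simpa using ⟨h₁, hr⟩

theorem ProductSem.stage_inv {y : Stage P Q} {α : List I} {w : List S} {n : M}
    (h : ProductSem P δ A₀ st ac [.nonterminal (.stage y, α)] w n) :
    ∃ w₀ w₁ n₀ n₁, w = w₀ ++ w₁ ∧ n = n₀ + n₁ ∧
      ProductSem P δ A₀ st ac (IndexedForm.attach α (y.done.map triSymbol)) w₀ n₀ ∧
      Yields P (IndexedForm.attach α y.todo) w₁ () ∧ WeightedRun δ y.src w₁ y.tgt n₁ := by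
  cases h with
  | stage h₀ h₁ hr h =>
    obtain ⟨rfl, rfl⟩ := h.nil_inv
    exact ⟨_, _, _, _, by simp, by simp, h₀, h₁, hr⟩

/-- Soundness of the product, by induction on the tree. The invariant for a stage is that `done`
already yields in the product, while for `todo` a word of the original grammar is read by a run from
`src` to `tgt`. -/
theorem Yields.productSem {x : IndexedForm S (ProductNT P Q) I} {w : List S} {n : M}
    (h : Yields (productRules P δ A₀ st ac) x w n) : ProductSem P δ A₀ st ac x w n := by
  induction h with
  | nil => exact .nil
  | terminal _ ih => exact .terminal ih
  | @nonterminal p A α β x w₁ w₂ n₁ n₂ hp hr _ _ ih₁ ih₂ =>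
    cases hp with
    | init hp hq =>
      cases hr
      obtain ⟨h₁, h₂⟩ := ProductSem.tri_inv ih₁
      rw [zero_add]
      exact .init hp hq h₁ h₂ ih₂
    | push h =>
      cases hr
      obtain ⟨h₁, h₂⟩ := ProductSem.tri_inv ih₁
      rw [zero_add]
      exact .tri (Yields.singleton (n := ()) h (.push _ _ _ _) h₁) h₂ ih₂
    | expand h =>
      cases hr
      obtain ⟨w₀, w₁, n₀, n₁, rfl, rfl, h₀, h₁, h₂⟩ := ProductSem.stage_inv ih₁
      obtain ⟨rfl, rfl⟩ := ProductSem.nil_inv h₀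
      rw [zero_add, zero_add]
      exact .tri (Yields.singleton (n := ()) h (.expand _ _ _) h₁) h₂ ih₂
    | pop h =>
      cases hr
      obtain ⟨w₀, w₁, n₀, n₁, rfl, rfl, h₀, h₁, h₂⟩ := ProductSem.stage_inv ih₁
      obtain ⟨rfl, rfl⟩ := ProductSem.nil_inv h₀
      rw [zero_add, zero_add]
      exact .tri (Yields.singleton (n := ()) h (.pop _ _ _ _) h₁) h₂ ih₂
    | @eps _ _ _ _ _ _ m ht h h₁ h₂ =>
      cases hr
      obtain ⟨w₀, w₁, n₀, n₁, rfl, rfl, h₀, h₁, h₂⟩ := ProductSem.stage_inv ih₁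
      rw [add_left_comm m n₀ n₁]
      exact .stage h₀ h₁ (.eps ht h₂) ih₂
    | @read _ _ _ _ _ a _ m ht h h₁ h₂ =>
      cases hr
      obtain ⟨w₀, w₁, n₀, n₁, rfl, rfl, h₀, h₁, h₂⟩ := ProductSem.stage_inv ih₁
      rw [List.map_append, attach_append] at h₀
      obtain ⟨v, v', l, l', rfl, rfl, h₀', h₃⟩ := h₀.of_append
      cases h₃ with
      | terminal h₃ =>
        obtain ⟨rfl, rfl⟩ := ProductSem.nil_inv h₃
        rw [add_zero, add_left_comm m l n₁, List.append_assoc v]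
        exact .stage h₀' (.terminal h₁) (.read ht h₂) ih₂
    | @jump _ _ p r _ A _ h h₁ h₂ =>
      cases hr
      obtain ⟨w₀, w₁, n₀, n₁, rfl, rfl, h₀, h₁, h₂⟩ := ProductSem.stage_inv ih₁
      rw [List.map_append, attach_append] at h₀
      obtain ⟨v, v', l, l', rfl, rfl, h₀', h₃⟩ := h₀.of_append
      obtain ⟨h₃, h₄⟩ := ProductSem.tri_inv h₃
      rw [zero_add, add_assoc l, List.append_assoc v]
      exact .stage h₀' (Yields.append (n₁ := ()) (n₂ := ()) h₃ h₁) (h₄.append h₂) ih₂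
    | @release _ _ q h h₁ =>
      cases hr
      -- With nothing left to scan, the run is the empty run at `q`, and all of the word comes from
      -- `done`.
      have := ProductSem.stage (y := ⟨_, _, q, [], q, h, h₁⟩) ih₁ .nil (.nil q) ih₂
      simpa using this

/-- The scan of a sentential form by the automaton, which jumps over the nonterminals. -/
inductive Scan (P : Set (IndexedProduction S N I × Unit))
    (δ : Set (Q × Option S × M × Q)) (A₀ : N) (st ac : Set Q) :
    Q → IndexedForm S N I → Q → List S → M → Prop
  | nil (q : Q) : Scan P δ A₀ st ac q [] q [] 0
  | eps {p r q : Q} {y : IndexedForm S N I} {w : List S} {m n : M} (ht : (p, none, m, r) ∈ δ)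
      (h : Scan P δ A₀ st ac r y q w n) : Scan P δ A₀ st ac p y q w (m + n)
  | read {p r q : Q} {a : S} {y : IndexedForm S N I} {w : List S} {m n : M}
      (ht : (p, some a, m, r) ∈ δ) (h : Scan P δ A₀ st ac r y q w n) :
      Scan P δ A₀ st ac p (.terminal a :: y) q (a :: w) (m + n)
  | jump {p r q : Q} {A : N} {α : List I} {y : IndexedForm S N I} {w₁ w₂ : List S} {n₁ n₂ : M}
      (h₁ : Yields (productRules P δ A₀ st ac) [.nonterminal (.tri (p, A, r), α)] w₁ n₁)
      (h : Scan P δ A₀ st ac r y q w₂ n₂) :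
      Scan P δ A₀ st ac p (.nonterminal (A, α) :: y) q (w₁ ++ w₂) (n₁ + n₂)

/-- A scan is replayed as a chain of stages. The induction generalizes over the part `ν'` already
scanned and over what it yields, because stages only release their symbols at the end. -/
theorem Scan.yields {p q : Q} {α : List I} {ν : List (Symbol S N)} {w : List S} {n : M}
    (h : Scan P δ A₀ st ac p (IndexedForm.attach α ν) q w n) {π : IndexedProduction S N I}
    {ν' : List (Symbol S (Q × N × Q))} (hπ : (π, ()) ∈ P)
    (hν : rhs? π = some (ν'.map eraseStates ++ ν)) {w₀ : List S} {n₀ : M}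
    (h₀ : Yields (productRules P δ A₀ st ac) (IndexedForm.attach α (ν'.map triSymbol)) w₀ n₀) :
    Yields (productRules P δ A₀ st ac)
      [.nonterminal (.stage ⟨π, ν', p, ν, q, hπ, hν⟩, α)] (w₀ ++ w) (n₀ + n) := by
  generalize hy : IndexedForm.attach α ν = y at h
  induction h generalizing ν ν' w₀ n₀ with
  | nil q =>
    cases List.map_eq_nil_iff.1 hy
    have := Yields.singleton (R := productRules P δ A₀ st ac)
          (ProductRule.release (q := q) hπ hν)
      (.expand _ _ _) h₀
    simpa using this
  | @eps p r q y w m n ht h ih =>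
    have := Yields.singleton (R := productRules P δ A₀ st ac)
          (ProductRule.eps ht hπ hν hν)
      (.expand _ _ _) (ih hν h₀ hy)
    rwa [add_left_comm n₀ m n]
  | @read p r q a y w m n ht h ih =>
    cases ν with
    | nil => cases hy
    | cons s ν =>
      cases s with
      | nonterminal A => cases hy
      | terminal b =>
        cases hy
        have hν' : rhs? π = some ((ν' ++ [Symbol.terminal a]).map eraseStates ++ ν) := by
          rw [hν]; simp [eraseStates]
        have h₁ : Yields (productRules P δ A₀ st ac)
            (IndexedForm.attach α ((ν' ++ [Symbol.terminal a]).map triSymbol)) (w₀ ++ [a]) n₀ := by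
          rw [List.map_append, attach_append, ← add_zero n₀]
          exact h₀.append (.terminal .nil)
        have := Yields.singleton (R := productRules P δ A₀ st ac)
          (ProductRule.read ht hπ hν hν')
          (.expand _ _ _) (ih hν' h₁ rfl)
        rw [add_left_comm n₀ m n]
        simpa using this
  | @jump p r q A α' y w₁ w₂ n₁ n₂ h₁ h ih =>
    cases ν with
    | nil => cases hy
    | cons s ν =>
      cases s with
      | terminal b => cases hy
      | nonterminal B =>
        cases hy
        have hν' : rhs? π = some ((ν' ++ [Symbol.nonterminal (p, A, r)]).map eraseStates ++ ν) := by
          rw [hν]; simp [eraseStates]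
        have h₂ : Yields (productRules P δ A₀ st ac)
            (IndexedForm.attach α ((ν' ++ [Symbol.nonterminal (p, A, r)]).map triSymbol))
            (w₀ ++ w₁) (n₀ + n₁) := by
          rw [List.map_append, attach_append]
          exact h₀.append h₁
        have := Yields.singleton (R := productRules P δ A₀ st ac)
          (ProductRule.jump hπ hν hν')
          (.expand _ _ _) (ih hν' h₂ rfl)
        rw [← add_assoc]
        simpa using this

/-- Completeness of the product. The two claims are proved together: expanding and popping need a
scan of the right-hand side, whereas a push keeps the states `p` and `q` and needs the triple for
the nonterminal with the larger stack. -/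
theorem scan_and_yields_of_yields {y : IndexedForm S N I} {w : List S} {u : Unit}
    (h : Yields P y w u) :
    (∀ {p q : Q} {n : M}, WeightedRun δ p w q n → Scan P δ A₀ st ac p y q w n) ∧
      ∀ {A : N} {α : List I}, y = [.nonterminal (A, α)] → ∀ {p q : Q} {n : M},
        WeightedRun δ p w q n →
          Yields (productRules P δ A₀ st ac) [.nonterminal (.tri (p, A, q), α)] w n := by
  induction h with
  | nil =>
    refine ⟨fun {p q n} hr => ?_, by simp⟩
    generalize hw : [] = w at hr
    induction hr with
    | nil q => exact .nil q
    | eps ht _ ih => exact .eps ht (ih hw)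
    | read => cases hw
  | @terminal a x w _ _ ih =>
    refine ⟨fun {p q n} hr => ?_, by simp⟩
    generalize hw : a :: w = w' at hr
    induction hr with
    | nil q => cases hw
    | eps ht _ ih => exact .eps ht (ih hw)
    | read ht hr => cases hw; exact .read ht (ih.1 hr)
  | @nonterminal π A α β x w₁ w₂ _ _ hp hrep _ hx ih₁ ih₂ =>
    have key : ∀ {p r : Q} {n : M}, WeightedRun δ p w₁ r n →
        Yields (productRules P δ A₀ st ac) [.nonterminal (.tri (p, A, r), α)] w₁ n := by
      intro p r n hr
      obtain ⟨π, _⟩ := π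
      cases hrep with
      | expand A ν α =>
        have := (ih₁.1 hr).yields hp (ν' := []) rfl .nil
        simpa using Yields.singleton (R := productRules P δ A₀ st ac)
          (ProductRule.expand hp) (.expand _ _ _) this
      | push A B f α =>
        simpa using Yields.singleton (R := productRules P δ A₀ st ac)
          (ProductRule.push hp) (.push _ _ _ _)
          (ih₁.2 rfl hr)
      | pop A f ν α =>
        have := (ih₁.1 hr).yields hp (ν' := []) rfl .nil
        simpa using Yields.singleton (R := productRules P δ A₀ st ac)
          (ProductRule.pop hp) (.pop _ _ _ _) this
    constructor
    · intro p q n hr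
      -- The state `r` between the two parts of the word is the one guessed by the jump over `A`.
      obtain ⟨r, n₁, n₂, rfl, h₁, h₂⟩ := hr.of_append
      exact .jump (key h₁) (ih₂.1 h₂)
    · intro B γ hB p q n hr
      cases hB
      cases hx
      rw [List.append_nil] at hr ⊢
      exact key hr

theorem yields_productRules_iff {w : List S} {n : M} :
    Yields (productRules P δ A₀ st ac) [.nonterminal (.init, [])] w n ↔
      Yields P [.nonterminal (A₀, [])] w () ∧ ∃ p ∈ st, ∃ q ∈ ac, WeightedRun δ p w q n := by
  constructor
  · intro h
    cases h.productSem with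
    | init hp hq h₁ hr h' =>
      obtain ⟨rfl, rfl⟩ := h'.nil_inv
      rw [List.append_nil, add_zero]
      exact ⟨h₁, _, hp, _, hq, hr⟩
  · rintro ⟨h, p, hp, q, hq, hr⟩
    have := Yields.singleton (R := productRules P δ A₀ st ac)
          (ProductRule.init hp hq)
      (.expand _ _ _) ((scan_and_yields_of_yields h).2 rfl hr)
    simpa using this

end WeightedIndexed

namespace Language

open WeightedIndexed

theorem IsUFIN.inf_isUFINc {S : Type} [Finite S] {L : Language S} (hL : L.IsUFIN) {Q : Type}
    [Finite Q] {k : ℕ} {δ : Set (Q × Option S × (Fin k → ℕ) × Q)} (hδ : δ.Finite) (st ac : Set Q)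
    {L' : Language S} (hL' : ∀ w, w ∈ L' ↔
      ∃ p ∈ st, ∃ q ∈ ac, ∃ n, WeightedRun δ p w q n ∧ ∀ i j, n i = n j) :
    (L ⊓ L').IsUFINc := by
  obtain ⟨N, I, _, _, A, P, r, hP, hr, hL⟩ := isUFIN_iff.1 hL
  refine isUFINc_iff.2 ⟨k, ProductNT P Q, I, finite_productNT hP, ‹_›, .init,
    productRules P δ A st ac, r, finite_productRules hP hδ A st ac, hr.product, fun w => ?_⟩
  simp only [yields_productRules_iff]
  have : w ∈ L ⊓ L' ↔ w ∈ L ∧ w ∈ L' := Iff.rfl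
  rw [this, hL, hL']
  constructor
  · rintro ⟨h, p, hp, q, hq, n, hn, he⟩
    exact ⟨n, ⟨h, p, hp, q, hq, hn⟩, he⟩
  · rintro ⟨n, ⟨h, p, hp, q, hq, hn⟩, he⟩
    exact ⟨h, p, hp, q, hq, n, hn, he⟩

end Language

/-! ### From semilinear acceptance to equality of counters -/

namespace WeightedRun

section

variable {S Q M : Type*} [AddCommMonoid M] {δ : Set (Q × Option S × M × Q)}

/-- The weights of the loops at a state that read no input. -/
def loops (δ : Set (Q × Option S × M × Q)) (q : Q) : AddSubmonoid M where
  carrier := {n | WeightedRun δ q [] q n}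
  zero_mem' := .nil q
  add_mem' h h' := by simpa using h.append h'

theorem single_eps {p q : Q} {m : M} (h : (p, none, m, q) ∈ δ) : WeightedRun δ p [] q m := by
  simpa using WeightedRun.eps h (.nil q)

end

variable {S Q ι J K : Type} {δ : Set (Q × Option S × (J → ℕ) × Q)}

/-- Put a vector into the first half of the counters. -/
def toFst (e : K ≃ J × Bool) : (J → ℕ) →+ (K → ℕ) where
  toFun x i := if (e i).2 then 0 else x (e i).1
  map_zero' := by ext; simp
  map_add' x y := by ext i; simp only [Pi.add_apply]; split <;> simp

/-- Put a vector into the second half of the counters. -/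
def toSnd (e : K ≃ J × Bool) : (J → ℕ) →+ (K → ℕ) where
  toFun x i := if (e i).2 then x (e i).1 else 0
  map_zero' := by ext; simp
  map_add' x y := by ext i; simp only [Pi.add_apply]; split <;> simp

/-- Put a vector into both halves of the counters. -/
def toBoth (e : K ≃ J × Bool) : (J → ℕ) →+ (K → ℕ) where
  toFun x i := x (e i).1
  map_zero' := by ext; simp
  map_add' x y := by ext i; simp

/-- The transitions of the automaton that guesses an element of the linear set with base `a i` and
periods `t i` in the second half of the counters, then runs the given automaton on the first half;
before that, both halves may be increased simultaneously. -/
inductive GuessRule (e : K ≃ J × Bool) (δ : Set (Q × Option S × (J → ℕ) × Q)) (st : Set Q)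
    (a : ι → J → ℕ) (t : ι → Set (J → ℕ)) :
    (ι × Option Q) × Option S × (K → ℕ) × (ι × Option Q) → Prop
  | period (i : ι) {g : J → ℕ} (hg : g ∈ t i) :
      GuessRule e δ st a t ((i, none), none, toSnd e g, (i, none))
  | pad [DecidableEq J] (i : ι) (j : J) :
      GuessRule e δ st a t ((i, none), none, toBoth e (Pi.single j 1), (i, none))
  | base (i : ι) {q : Q} (hq : q ∈ st) :
      GuessRule e δ st a t ((i, none), none, toSnd e (a i), (i, some q))
  | run (i : ι) {p q : Q} {o : Option S} {m : J → ℕ} (h : (p, o, m, q) ∈ δ) :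
      GuessRule e δ st a t ((i, some p), o, toFst e m, (i, some q))

/-- The set of transitions given by `GuessRule`. -/
def guessRules (e : K ≃ J × Bool) (δ : Set (Q × Option S × (J → ℕ) × Q)) (st : Set Q)
    (a : ι → J → ℕ) (t : ι → Set (J → ℕ)) :
    Set ((ι × Option Q) × Option S × (K → ℕ) × (ι × Option Q)) :=
  {x | GuessRule e δ st a t x}

variable {e : K ≃ J × Bool} {st : Set Q} {a : ι → J → ℕ} {t : ι → Set (J → ℕ)}

theorem finite_guessRules [Finite Q] [Finite ι] [Finite J] (hδ : δ.Finite)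
    (ht : ∀ i, (t i).Finite) : (guessRules e δ st a t).Finite := by
  classical
  let R₁ : Set ((ι × Option Q) × Option S × (K → ℕ) × (ι × Option Q)) :=
    ⋃ i, (fun g => ((i, none), none, toSnd e g, (i, none))) '' t i
  let R₂ : Set ((ι × Option Q) × Option S × (K → ℕ) × (ι × Option Q)) :=
    Set.range fun x : ι × J => ((x.1, none), none, toBoth e (Pi.single x.2 1), (x.1, none))
  let R₃ : Set ((ι × Option Q) × Option S × (K → ℕ) × (ι × Option Q)) :=
    Set.range fun x : ι × Q => ((x.1, none), none, toSnd e (a x.1), (x.1, some x.2))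
  let R₄ : Set ((ι × Option Q) × Option S × (K → ℕ) × (ι × Option Q)) :=
    ⋃ i, (fun x : Q × Option S × (J → ℕ) × Q =>
      ((i, some x.1), x.2.1, toFst e x.2.2.1, (i, some x.2.2.2))) '' δ
  have hR : (R₁ ∪ R₂ ∪ R₃ ∪ R₄).Finite :=
    (((Set.finite_iUnion fun i => (ht i).image _).union (Set.finite_range _)).union
      (Set.finite_range _)).union (Set.finite_iUnion fun i => hδ.image _)
  refine hR.subset fun x hx => ?_
  cases hx with
  | period i hg => exact .inl (.inl (.inl (Set.mem_iUnion.2 ⟨i, _, hg, rfl⟩)))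
  -- The decidability instance carried by `pad` is arbitrary; `congr!` identifies it with the
  -- classical one.
  | pad i j => exact .inl (.inl (.inr ⟨(i, j), by congr!⟩))
  | base i hq => exact .inl (.inr ⟨(i, _), rfl⟩)
  | run i h => exact .inr (Set.mem_iUnion.2 ⟨i, _, h, rfl⟩)

theorem guessRules_of_run (i : ι) {p q : Q} {w : List S} {m : J → ℕ} (h : WeightedRun δ p w q m) :
    WeightedRun (guessRules e δ st a t) (i, some p) w (i, some q) (toFst e m) := by
  induction h with
  | nil => rw [map_zero]; exact .nil _
  | eps ht _ ih => rw [map_add]; exact .eps (.run i ht) ih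
  | read ht _ ih => rw [map_add]; exact .read (.run i ht) ih

/-- Control passes from `none` to `some` once and never back. Before that only periods and pads are
added, in any order, so by commutativity they can be collected in `b` and `c`; afterwards only the
given automaton moves. -/
theorem of_guessRules {x y : ι × Option Q} {w : List S} {n : K → ℕ}
    (h : WeightedRun (guessRules e δ st a t) x w y n) {q : Q} (hy : y.2 = some q) :
    x.1 = y.1 ∧ (∀ p, x.2 = some p → ∃ m, n = toFst e m ∧ WeightedRun δ p w q m) ∧
      (x.2 = none → ∃ p ∈ st, ∃ m, ∃ b ∈ AddSubmonoid.closure (t x.1), ∃ c,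
        n = toSnd e b + toBoth e c + toSnd e (a x.1) + toFst e m ∧ WeightedRun δ p w q m) := by
  induction h with
  | nil x =>
    refine ⟨rfl, fun p hp => ⟨0, by simp, ?_⟩, fun h => by simp [hy] at h⟩
    rw [hy] at hp
    cases hp
    exact .nil _
  | eps ht _ ih =>
    obtain ⟨ih₁, ih₂, ih₃⟩ := ih hy
    cases ht with
    | period i hg =>
      refine ⟨ih₁, by simp, fun _ => ?_⟩
      obtain ⟨p, hp, m, b, hb, c, rfl, hr⟩ := ih₃ rfl
      exact ⟨p, hp, m, _, add_mem (AddSubmonoid.subset_closure hg) hb, c, by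
        simp only [map_add]; abel, hr⟩
    | pad i j =>
      refine ⟨ih₁, by simp, fun _ => ?_⟩
      obtain ⟨p, hp, m, b, hb, c, rfl, hr⟩ := ih₃ rfl
      exact ⟨p, hp, m, b, hb, Pi.single j 1 + c, by simp only [map_add]; abel, hr⟩
    | base i hq =>
      refine ⟨ih₁, by simp, fun _ => ?_⟩
      obtain ⟨m, rfl, hr⟩ := ih₂ _ rfl
      exact ⟨_, hq, m, 0, zero_mem _, 0, by simp, hr⟩
    | run i h =>
      refine ⟨ih₁, ?_, by simp⟩
      rintro _ ⟨⟩
      obtain ⟨m, rfl, hr⟩ := ih₂ _ rfl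
      exact ⟨_, (map_add _ _ _).symm, .eps h hr⟩
  | read ht _ ih =>
    obtain ⟨ih₁, ih₂, -⟩ := ih hy
    cases ht with
    | run i h =>
      refine ⟨ih₁, ?_, by simp⟩
      rintro _ ⟨⟩
      obtain ⟨m, rfl, hr⟩ := ih₂ _ rfl
      exact ⟨_, (map_add _ _ _).symm, .read h hr⟩

/-- At the end the copies of coordinate `j` hold `c j + m j` and `b j + c j + a i j`. If all
counters are equal, the padding cancels and `m = a i + b`; conversely, suitable padding makes all
coordinates equal. -/
theorem exists_guessRules_iff [Finite J] {ac : Set Q} {w : List S} :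
    (∃ p ∈ {x : ι × Option Q | x.2 = none}, ∃ q ∈ {x : ι × Option Q | ∃ q ∈ ac, x.2 = some q},
      ∃ n, WeightedRun (guessRules e δ st a t) p w q n ∧ ∀ i j, n i = n j) ↔
    ∃ p ∈ st, ∃ q ∈ ac, ∃ i, ∃ b ∈ AddSubmonoid.closure (t i), WeightedRun δ p w q (a i + b) := by
  classical
  have := Fintype.ofFinite J
  constructor
  · rintro ⟨⟨i, x⟩, rfl, ⟨i', y⟩, ⟨q, hq, rfl⟩, n, hn, he⟩
    obtain ⟨-, -, h⟩ := of_guessRules hn rfl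
    obtain ⟨p, hp, m, b, hb, c, rfl, hr⟩ := h rfl
    refine ⟨p, hp, q, hq, i, b, hb, ?_⟩
    have hm : m = a i + b := by
      ext j
      -- Only the two copies of the same coordinate are compared; equality across coordinates gives
      -- no further condition.
      have := he (e.symm (j, false)) (e.symm (j, true))
      simp [toFst, toSnd, toBoth] at this
      simp only [Pi.add_apply]
      omega
    rwa [← hm]
  · rintro ⟨p, hp, q, hq, i, b, hb, hr⟩
    -- The common final value is the sum of all coordinates, which bounds each of them, so the
    -- subtraction does not truncate.
    let c : J → ℕ := fun j => ∑ j', (a i + b) j' - (a i + b) j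
    have h₁ : WeightedRun (guessRules e δ st a t) (i, none) [] (i, none) (toSnd e b) := by
      have : AddSubmonoid.closure (t i) ≤
          (loops (guessRules e δ st a t) (i, none)).comap (toSnd e) :=
        (AddSubmonoid.closure_le).2 fun g hg => single_eps (.period i hg)
      exact this hb
    have h₂ : WeightedRun (guessRules e δ st a t) (i, none) [] (i, none) (toBoth e c) := by
      -- The pads are unit vectors and the loop weights form a submonoid, so any `c` is reached.
      suffices c ∈ (loops (guessRules e δ st a t) (i, none)).comap (toBoth e) from this
      rw [← Finset.univ_sum_single c]
      refine sum_mem fun j _ => ?_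
      have : (Pi.single j (c j) : J → ℕ) = c j • Pi.single j 1 := by
        rw [← Pi.single_smul]; simp
      rw [this]
      exact nsmul_mem (show _ ∈ AddSubmonoid.comap _ _ from single_eps (.pad i j)) _
    have h₃ : WeightedRun (guessRules e δ st a t) (i, none) [] (i, some p) (toSnd e (a i)) :=
      single_eps (.base i hp)
    have h₄ := ((h₁.append h₂).append h₃).append (guessRules_of_run (st := st) (a := a) (t := t)
      (e := e) i hr)
    refine ⟨(i, none), rfl, (i, some q), ⟨q, hq, rfl⟩, _, h₄, ?_⟩
    suffices h : ∀ i', (toSnd e b + toBoth e c + toSnd e (a i) + toFst e (a i + b)) i' =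
        ∑ j', (a i + b) j' from fun i' j' => by rw [h, h]
    intro k
    have hle : (a i + b) (e k).1 ≤ ∑ j', (a i + b) j' :=
      Finset.single_le_sum (fun _ _ => Nat.zero_le _) (Finset.mem_univ _)
    simp only [toSnd, toBoth, toFst, AddMonoidHom.coe_mk, ZeroHom.coe_mk, Pi.add_apply, c] at hle ⊢
    split <;> omega

end WeightedRun

namespace Language

open scoped Pointwise in
-- The linear component of `V` is guessed by the choice of the initial state, whose first entry
-- never changes.
theorem IsUFIN.inf_isUFINc_of_isSemilinearSet {S : Type} [Finite S] {L : Language S}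
    (hL : L.IsUFIN) {Q J : Type} [Finite Q] [Finite J] {δ : Set (Q × Option S × (J → ℕ) × Q)}
    (hδ : δ.Finite) (st ac : Set Q) {V : Set (J → ℕ)} (hV : IsSemilinearSet V)
    {L' : Language S} (hL' : ∀ w, w ∈ L' ↔ ∃ p ∈ st, ∃ q ∈ ac, ∃ n ∈ V, WeightedRun δ p w q n) :
    (L ⊓ L').IsUFINc := by
  obtain ⟨F, hF, hlin, rfl⟩ := hV
  choose a t ht hat using fun i : F => hlin i i.2
  have := hF.to_subtype
  obtain ⟨k, ⟨e⟩⟩ := Finite.exists_equiv_fin (J × Bool)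
  refine hL.inf_isUFINc (k := k)
    (WeightedRun.finite_guessRules (e := e.symm) (st := st) (a := a) hδ ht)
    {x | x.2 = none} {x | ∃ q ∈ ac, x.2 = some q} fun w => ?_
  rw [hL', WeightedRun.exists_guessRules_iff]
  refine exists_congr fun p => and_congr_right fun _ => exists_congr fun q =>
    and_congr_right fun _ => ?_
  constructor
  · rintro ⟨n, ⟨v, hv, hn⟩, hr⟩
    have hn' : n ∈ a ⟨v, hv⟩ +ᵥ (AddSubmonoid.closure (t ⟨v, hv⟩) : Set (J → ℕ)) := by
      rw [← hat]; exact hn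
    obtain ⟨b, hb, rfl⟩ := hn'
    exact ⟨⟨v, hv⟩, b, hb, hr⟩
  · rintro ⟨i, b, hb, hr⟩
    refine ⟨a i + b, ⟨i, i.2, ?_⟩, hr⟩
    rw [hat]
    exact ⟨b, hb, rfl⟩

end Language

/-! ### Verifying the tests of one counter by counting -/

namespace CounterSegment

/-- The kinds of segments in the history of a reversal-bounded counter: the counter is zero and
stays zero, it becomes positive, it is positive and does not decrease, it does not increase and
remains positive, it becomes zero. -/
inductive Kind
  | zero | jump | up | down | hit

/-- The kind of the segment with number `s`. The segments `3 ρ`, `3 ρ + 1` and `3 ρ + 2` belong to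
the phase after `ρ` reversals. -/
def kind (s : ℕ) : Kind :=
  if s / 3 % 2 = 0 then
    if s % 3 = 0 then .zero else if s % 3 = 1 then .jump else .up
  else
    if s % 3 = 0 then .down else if s % 3 = 1 then .hit else .zero

/-- The tests and changes of a counter that may occur in a segment. -/
def Kind.Compat : Kind → Bool → SignType → Prop
  | .zero, b, c => b = false ∧ c = 0
  | .jump, b, c => b = false ∧ c = 1
  | .up, b, c => b = true ∧ (c = 0 ∨ c = 1)
  | .down, b, c => b = true ∧ (c = 0 ∨ c = -1)
  | .hit, b, c => b = true ∧ c = -1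

/-- The condition on the value at the beginning of a segment. -/
def Kind.CheckBegin : Kind → ℤ → Prop
  | .zero, v => v = 0
  | .jump, v => v = 0
  | .up, v => 0 < v
  | .down, _ => True
  | .hit, _ => True

/-- The condition on the value at the end of a segment. -/
def Kind.CheckEnd : Kind → ℤ → Prop
  | .zero, _ => True
  | .jump, v => v ≤ 1
  | .up, _ => True
  | .down, v => 0 < v
  | .hit, v => 0 ≤ v

/-- A move as seen by one counter: the number of the segment, whether the counter is required to be
positive, and its change. -/
abbrev Move := ℕ × Bool × SignType

/-- The moves are possible when the counter has the value `v` before. -/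
def Valid : ℤ → List Move → Prop
  | _, [] => True
  | v, a :: l => (0 < v ↔ a.2.1 = true) ∧ 0 ≤ v + (a.2.2 : ℤ) ∧ Valid (v + (a.2.2 : ℤ)) l

/-- Each move satisfies the conditions of its segment. -/
def LocalCheck : ℤ → List Move → Prop
  | _, [] => True
  | v, a :: l => (kind a.1).CheckBegin v ∧ (kind a.1).CheckEnd (v + (a.2.2 : ℤ)) ∧
      LocalCheck (v + (a.2.2 : ℤ)) l

/-- The change by moves in segments before `s`. -/
def before (s t : ℕ) (c : SignType) : ℤ := if t < s then (c : ℤ) else 0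

/-- The change by moves in segments up to `s`. -/
def upTo (s t : ℕ) (c : SignType) : ℤ := if t ≤ s then (c : ℤ) else 0

/-- The change by moves in segment `s`. -/
def within (s t : ℕ) (c : SignType) : ℤ := if t = s then (c : ℤ) else 0

/-- The number of moves in segment `s`. -/
def occurs (s t : ℕ) (_ : SignType) : ℤ := if t = s then 1 else 0

/-- The sum of a function over a list of moves. -/
def total (f : ℕ → SignType → ℤ) (l : List Move) : ℤ := (l.map fun a => f a.1 a.2.2).sum

/-- The moves are sorted by their segments. -/
def Sorted (l : List Move) : Prop := l.Pairwise fun a b => a.1 ≤ b.1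

variable {f g h : ℕ → SignType → ℤ} {l l' : List Move}

@[simp] theorem total_nil : total f [] = 0 := rfl

@[simp] theorem total_cons (a : Move) : total f (a :: l) = f a.1 a.2.2 + total f l := by
  simp [total]

@[simp] theorem total_append : total f (l ++ l') = total f l + total f l' := by
  simp [total]

theorem total_congr (h : ∀ a ∈ l, f a.1 a.2.2 = g a.1 a.2.2) : total f l = total g l := by
  unfold total
  rw [List.map_congr_left h]

theorem total_eq_add (hl : ∀ a ∈ l, f a.1 a.2.2 = g a.1 a.2.2 + h a.1 a.2.2) :
    total f l = total g l + total h l := by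
  rw [total_congr (g := fun s c => g s c + h s c) hl]
  simp [total, List.sum_map_add]

theorem total_eq_zero (hl : ∀ a ∈ l, f a.1 a.2.2 = 0) : total f l = 0 := by
  rw [total_congr (g := fun _ _ => 0) hl]
  simp [total]

theorem total_nonneg (hl : ∀ a ∈ l, 0 ≤ f a.1 a.2.2) : 0 ≤ total f l := by
  refine List.sum_nonneg fun x hx => ?_
  obtain ⟨a, ha, rfl⟩ := List.mem_map.1 hx
  exact hl a ha

theorem total_nonpos (hl : ∀ a ∈ l, f a.1 a.2.2 ≤ 0) : total f l ≤ 0 := by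
  have := total_nonneg (f := fun s c => - f s c) (l := l) (by simpa using hl)
  have h2 : total (fun _ _ => 0) l = total f l + total (fun s c => - f s c) l :=
    total_eq_add (by simp)
  rw [total_eq_zero (f := fun _ _ => 0) (by simp)] at h2
  omega

theorem exists_of_total_occurs_ne_zero {s : ℕ} (h : total (occurs s) l ≠ 0) : ∃ a ∈ l, a.1 = s := by
  by_contra hne
  push Not at hne
  exact h (total_eq_zero fun a ha => by simp [occurs, hne a ha])

theorem total_occurs_pos {s : ℕ} {a : Move} (ha : a ∈ l) (hs : a.1 = s) :
    total (occurs s) l ≠ 0 := by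
  have h1 : (0 : ℤ) ≤ total (occurs s) l := total_nonneg fun a _ => by
    unfold occurs; split <;> simp
  obtain ⟨l₁, l₂, rfl⟩ := List.append_of_mem ha
  have h2 : (0 : ℤ) ≤ total (occurs s) l₁ := total_nonneg fun a _ => by
    unfold occurs; split <;> simp
  have h3 : (0 : ℤ) ≤ total (occurs s) l₂ := total_nonneg fun a _ => by
    unfold occurs; split <;> simp
  have h4 : occurs s a.1 a.2.2 = 1 := by simp [occurs, hs]
  rw [total_append, total_cons, h4]
  omega

/-- The reason why finitely many inequalities replace all tests. Within a segment the changes do not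
differ in sign, so the value at any moment lies between those at the two ends of the segment, and
these ends are sums over the whole sequence. The list `pre` holds the moves already made. -/
theorem valid_append_of_check {pre : List Move} (hs : Sorted (pre ++ l))
    (hc : ∀ a ∈ pre ++ l, (kind a.1).Compat a.2.1 a.2.2)
    (hcheck : ∀ a ∈ pre ++ l, (kind a.1).CheckBegin (total (before a.1) (pre ++ l)) ∧
      (kind a.1).CheckEnd (total (upTo a.1) (pre ++ l))) :
    Valid (total (fun _ c => (c : ℤ)) pre) l := by
  induction l generalizing pre with
  | nil => trivial
  | cons a l ih =>
    have hassoc : pre ++ a :: l = (pre ++ [a]) ++ l := by simp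
    have hrest := ih (pre := pre ++ [a]) (by rwa [← hassoc]) (by rwa [← hassoc])
      (by rwa [← hassoc])
    have hpre : ∀ b ∈ pre, b.1 ≤ a.1 := fun b hb =>
      (List.pairwise_append.1 hs).2.2 b hb a (by simp)
    have hpost : ∀ b ∈ l, a.1 ≤ b.1 := fun b hb =>
      (List.pairwise_cons.1 (List.pairwise_append.1 hs).2.1).1 b hb
    have ha := hc a (by simp)
    obtain ⟨hB, hE⟩ := hcheck a (by simp)
    -- The value at the beginning of the current segment depends only on the past.
    have e₁ : total (before a.1) (pre ++ a :: l) = total (before a.1) pre := by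
      rw [total_append, total_cons, total_eq_zero (l := l)]
      · simp [before]
      · intro b hb
        have := hpost b hb
        simp only [before, ite_eq_right_iff]
        omega
    -- The value at the end of the segment is the present value plus this move and the later moves
    -- of the same segment.
    have e₂ : total (upTo a.1) (pre ++ a :: l) =
        total (fun _ c => (c : ℤ)) pre + a.2.2 + total (within a.1) l := by
      rw [total_append, total_cons, total_congr (l := l) (g := within a.1),
        total_congr (l := pre) (g := fun _ c => (c : ℤ))]
      · simp [upTo]; ring
      · intro b hb
        have := hpre b hb
        simp [upTo, this]
      · intro b hb
        have := hpost b hb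
        have h : b.1 ≤ a.1 ↔ b.1 = a.1 := by omega
        simp [upTo, within, h]
    -- The present value is the value at the beginning of the segment plus its moves so far.
    have e₃ : total (fun _ c => (c : ℤ)) pre =
        total (before a.1) pre + total (within a.1) pre := by
      apply total_eq_add
      intro b hb
      have := hpre b hb
      simp only [before, within]
      by_cases h : b.1 = a.1
      · simp [h]
      · simp [h, show b.1 < a.1 by omega]
    have hc₁ : ∀ b ∈ pre, b.1 = a.1 → (kind a.1).Compat b.2.1 b.2.2 := fun b hb h => by
      rw [← h]; exact hc b (by simp [hb])
    have hc₂ : ∀ b ∈ l, b.1 = a.1 → (kind a.1).Compat b.2.1 b.2.2 := fun b hb h => by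
      rw [← h]; exact hc b (by simp [hb])
    have hnonneg : ∀ l' : List Move, (∀ b ∈ l', b.1 = a.1 → b.2.2 = 0 ∨ b.2.2 = 1) →
        0 ≤ total (within a.1) l' := fun l' hl' => total_nonneg fun b hb => by
      unfold within
      split
      · rcases hl' b hb ‹_› with h | h <;> simp [h]
      · simp
    have hnonpos : ∀ l' : List Move, (∀ b ∈ l', b.1 = a.1 → b.2.2 = 0 ∨ b.2.2 = -1) →
        total (within a.1) l' ≤ 0 := fun l' hl' => total_nonpos fun b hb => by
      unfold within
      split
      · rcases hl' b hb ‹_› with h | h <;> simp [h]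
      · simp
    rw [e₁] at hB
    rw [e₂] at hE
    rw [total_append, total_cons, total_nil, add_zero] at hrest
    refine and_assoc.1 ⟨?_, hrest⟩
    -- For `zero` and `up` the condition at the beginning passes forward to this move; for `down`
    -- and `hit` the condition at the end passes back. For `jump`, beginning at `0` and ending at
    -- most at `1` forces the value `0` before this move.
    generalize kind a.1 = κ at *
    cases κ with
    | zero =>
      have h₁ := hnonneg pre fun b hb h => .inl (hc₁ b hb h).2
      have h₂ := hnonpos pre fun b hb h => .inl (hc₁ b hb h).2
      obtain ⟨h₃, h₄⟩ := ha
      simp only [Kind.CheckBegin] at hB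
      simp only [h₃, h₄, SignType.coe_zero]
      constructor <;> (try simp) <;> omega
    | jump =>
      have h₁ := hnonneg pre fun b hb h => .inr (hc₁ b hb h).2
      have h₂ := hnonneg l fun b hb h => .inr (hc₂ b hb h).2
      obtain ⟨h₃, h₄⟩ := ha
      simp only [Kind.CheckBegin, Kind.CheckEnd] at hB hE
      simp only [h₃, h₄, SignType.coe_one] at hE ⊢
      constructor <;> (try simp) <;> omega
    | up =>
      have h₁ := hnonneg pre fun b hb h => (hc₁ b hb h).2
      obtain ⟨h₃, h₄⟩ := ha
      simp only [Kind.CheckBegin] at hB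
      rcases h₄ with h₄ | h₄ <;> simp only [h₃, h₄, SignType.coe_one, SignType.coe_zero] <;>
        constructor <;> (try simp) <;> omega
    | down =>
      have h₁ := hnonpos l fun b hb h => (hc₂ b hb h).2
      obtain ⟨h₃, h₄⟩ := ha
      simp only [Kind.CheckEnd] at hE
      rcases h₄ with h₄ | h₄ <;>
        simp only [h₃, h₄, SignType.coe_neg_one, SignType.coe_zero] at hE ⊢ <;>
        constructor <;> (try simp) <;> omega
    | hit =>
      have h₁ := hnonpos l fun b hb h => .inr (hc₂ b hb h).2
      obtain ⟨h₃, h₄⟩ := ha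
      simp only [Kind.CheckEnd] at hE
      simp only [h₃, h₄, SignType.coe_neg_one] at hE ⊢
      constructor <;> (try simp) <;> omega

/-- The value at the beginning of a segment is the one before its first move, so the local condition
of that move suffices; the conditions of the other moves in the segment are not needed. -/
theorem checkBegin_of_localCheck {v : ℤ} (hs : Sorted l) (hl : LocalCheck v l) {a : Move}
    (ha : a ∈ l) : (kind a.1).CheckBegin (v + total (before a.1) l) := by
  induction l generalizing v with
  | nil => simp at ha
  | cons b l ih =>
    obtain ⟨hb, hs⟩ := List.pairwise_cons.1 hs
    obtain ⟨h₁, h₂, h₃⟩ := hl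
    by_cases hab : a.1 = b.1
    · rw [hab, total_eq_zero]
      · simpa using h₁
      · intro c hc
        have : b.1 ≤ c.1 := by
          rcases List.mem_cons.1 hc with rfl | hc
          · exact le_rfl
          · exact hb c hc
        simp [before, this]
    · have ha' : a ∈ l := (List.mem_cons.1 ha).resolve_left fun h => hab (by rw [h])
      have hlt : b.1 < a.1 := lt_of_le_of_ne (hb a ha') fun h => hab h.symm
      have := ih hs h₃ ha'
      rw [total_cons]
      simpa [before, hlt, add_assoc] using this

/-- Here the last move of the segment decides: while a later move of the same segment exists, `a` is
replaced by it. -/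
theorem checkEnd_of_localCheck {v : ℤ} (hs : Sorted l) (hl : LocalCheck v l) {a : Move}
    (ha : a ∈ l) : (kind a.1).CheckEnd (v + total (upTo a.1) l) := by
  induction l generalizing v a with
  | nil => simp at ha
  | cons b l ih =>
    obtain ⟨hb, hs⟩ := List.pairwise_cons.1 hs
    obtain ⟨h₁, h₂, h₃⟩ := hl
    have hle : b.1 ≤ a.1 := by
      rcases List.mem_cons.1 ha with rfl | ha
      · exact le_rfl
      · exact hb a ha
    rw [total_cons, show upTo a.1 b.1 b.2.2 = (b.2.2 : ℤ) by simp [upTo, hle], ← add_assoc]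
    by_cases h : ∃ c ∈ l, c.1 = a.1
    · obtain ⟨c, hc, hca⟩ := h
      rw [← hca]
      exact ih hs h₃ hc
    · push Not at h
      have hab : a = b := (List.mem_cons.1 ha).resolve_right fun h' => h a h' rfl
      subst hab
      rw [total_eq_zero (l := l), add_zero]
      · exact h₂
      · intro c hc
        have h' := hb c hc
        have := h c hc
        simp only [upTo, ite_eq_right_iff]
        omega

/-- The number of reversals after a move with change `c`, if there were `ρ` before. -/
def nextPhase (ρ : ℕ) (c : SignType) : ℕ :=
  if (c = 1 ∧ ρ % 2 = 1) ∨ (c = -1 ∧ ρ % 2 = 0) then ρ + 1 else ρ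

/-- The relation between the number of reversals, the last segment and the value of a counter. -/
def PhaseInv (ρ s : ℕ) (v : ℤ) : Prop :=
  s ≤ 3 * ρ + 2 ∧ (3 * ρ < s → if ρ % 2 = 0 then 0 < v else v = 0)

/-- The segment is chosen within the phase after the move. In a non-decreasing phase it is `zero`,
`jump` or `up`, according to whether the value stays `0`, leaves `0` or is positive; in a
non-increasing phase it is `down`, `hit` or `zero`, according to whether the value stays positive,
becomes `0` or is `0`. The invariant keeps the numbers from falling: past the first segment of a
phase, the value is positive in the former case and `0` in the latter. -/
theorem exists_segment {ρ s : ℕ} {v : ℤ} (hv : 0 ≤ v) (hs : PhaseInv ρ s v) {b : Bool}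
    {c : SignType} (hb : 0 < v ↔ b = true) (hc : 0 ≤ v + c) :
    ∃ s', s ≤ s' ∧ s' ≤ 3 * nextPhase ρ c + 2 ∧ (kind s').Compat b c ∧ (kind s').CheckBegin v ∧
      (kind s').CheckEnd (v + c) ∧ PhaseInv (nextPhase ρ c) s' (v + c) := by
  obtain ⟨hs₁, hs₂⟩ := hs
  have hle : ρ ≤ nextPhase ρ c := by unfold nextPhase; split <;> omega
  have hpar : (nextPhase ρ c % 2 = 0 → c = 0 ∨ c = 1) ∧
      (nextPhase ρ c % 2 = 1 → c = 0 ∨ c = -1) := by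
    unfold nextPhase
    rcases Nat.mod_two_eq_zero_or_one ρ with h | h <;> cases c <;> simp [h] <;> omega
  -- A new phase begins beyond every segment of the old one, since `s ≤ 3 * ρ + 2`.
  have hs₃ : nextPhase ρ c = ρ ∨ s < 3 * nextPhase ρ c := by
    unfold nextPhase; split <;> omega
  have hs₄ : nextPhase ρ c = ρ → 3 * nextPhase ρ c < s →
      if nextPhase ρ c % 2 = 0 then 0 < v else v = 0 := by
    intro h; rw [h]; exact hs₂
  generalize nextPhase ρ c = ρ' at *
  have hkind : ∀ τ < 3, kind (3 * ρ' + τ) = if ρ' % 2 = 0 then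
      (if τ = 0 then .zero else if τ = 1 then .jump else .up) else
      (if τ = 0 then .down else if τ = 1 then .hit else .zero) := by
    intro τ hτ
    unfold kind
    rw [show (3 * ρ' + τ) / 3 = ρ' by omega, show (3 * ρ' + τ) % 3 = τ by omega]
  have hkind₀ := hkind 0 (by omega)
  rw [add_zero] at hkind₀
  suffices h : ∃ τ < 3, s ≤ 3 * ρ' + τ ∧ (kind (3 * ρ' + τ)).Compat b c ∧
      (kind (3 * ρ' + τ)).CheckBegin v ∧ (kind (3 * ρ' + τ)).CheckEnd (v + c) ∧
      (0 < τ → if ρ' % 2 = 0 then 0 < v + c else v + c = 0) by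
    obtain ⟨τ, hτ, h₁, h₂, h₃, h₄, h₅⟩ := h
    exact ⟨3 * ρ' + τ, h₁, by omega, h₂, h₃, h₄, by omega, fun h => h₅ (by omega)⟩
  rcases Nat.mod_two_eq_zero_or_one ρ' with hρ | hρ
  · simp only [hρ, if_true] at hkind hkind₀ hs₄ ⊢
    rcases (show v = 0 ∨ 0 < v by omega) with hv₀ | hv₀
    · have hb' : b = false := by simpa [hv₀] using hb
      rcases hpar.1 hρ with rfl | rfl
      · exact ⟨0, by omega, by omega, by simp [hkind₀, Kind.Compat, hb'],
          by simp [hkind₀, Kind.CheckBegin, hv₀], by simp [hkind₀, Kind.CheckEnd], by simp⟩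
      · exact ⟨1, by omega, by omega, by simp [hkind, Kind.Compat, hb'],
          by simp [hkind, Kind.CheckBegin, hv₀], by simp [hkind, Kind.CheckEnd, hv₀],
          by simp [hv₀]⟩
    · have hb' : b = true := hb.1 hv₀
      refine ⟨2, by omega, by omega, by simp [hkind, Kind.Compat, hb', hpar.1 hρ],
          by simp [hkind, Kind.CheckBegin, hv₀], by simp [hkind, Kind.CheckEnd], fun _ => ?_⟩
      rcases hpar.1 hρ with rfl | rfl <;> simp <;> omega
  · simp only [hρ, one_ne_zero, if_false] at hkind hkind₀ hs₄ ⊢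
    rcases (show v = 0 ∨ 0 < v by omega) with hv₀ | hv₀
    · have hb' : b = false := by simpa [hv₀] using hb
      have hc' : c = 0 := by
        rcases hpar.2 hρ with rfl | rfl
        · rfl
        · simp [hv₀] at hc
      exact ⟨2, by omega, by omega, by simp [hkind, Kind.Compat, hb', hc'],
          by simp [hkind, Kind.CheckBegin, hv₀], by simp [hkind, Kind.CheckEnd],
          by simp [hv₀, hc']⟩
    · have hb' : b = true := hb.1 hv₀
      rcases (show v + c = 0 ∨ 0 < v + (c : ℤ) by omega) with hv₁ | hv₁
      · have hc' : c = -1 := by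
          rcases hpar.2 hρ with rfl | rfl
          · simp at hv₁; omega
          · rfl
        exact ⟨1, by omega, by omega, by simp [hkind, Kind.Compat, hb', hc'],
          by simp [hkind, Kind.CheckBegin], by simp [hkind, Kind.CheckEnd, hv₁], by simp [hv₁]⟩
      · exact ⟨0, by omega, by omega, by simp [hkind₀, Kind.Compat, hb', hpar.2 hρ],
          by simp [hkind₀, Kind.CheckBegin], by simp [hkind₀, Kind.CheckEnd, hv₁], by simp⟩

/-- The reversals made plus those still to come are constant along a computation. The current
direction is the parity of the reversals made, because the first phase is non-decreasing. -/
theorem counterReversals_nextPhase {ρ v v' : ℕ} {c : SignType} (h : (v' : ℤ) = v + c)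
    (l : List ℕ) :
    counterReversals (decide (nextPhase ρ c % 2 = 1)) (v' :: l) + nextPhase ρ c =
      counterReversals (decide (ρ % 2 = 1)) (v :: v' :: l) + ρ := by
  rw [counterReversals]
  unfold nextPhase
  rcases Nat.mod_two_eq_zero_or_one ρ with hρ | hρ <;> cases c <;>
    simp only [SignType.zero_eq_zero, SignType.neg_eq_neg_one, SignType.pos_eq_one,
      SignType.coe_zero, SignType.coe_one, SignType.coe_neg_one] at h
  · have h' : v = v' := by omega
    simp [h', hρ]
  · have h' : v' < v := by omega
    have h'' : ¬ v < v' := by omega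
    simp [h', h'', hρ, Nat.add_mod]; omega
  · have h' : v < v' := by omega
    simp [h', hρ]
  · have h' : v = v' := by omega
    simp [h', hρ]
  · have h' : v' < v := by omega
    have h'' : ¬ v < v' := by omega
    simp [h', h'', hρ]
  · have h' : v < v' := by omega
    simp [h', hρ, Nat.add_mod]; omega

end CounterSegment

/-! ### Reversal-bounded machines as weighted automata -/

namespace CounterMachine

open CounterSegment

variable {T : Type*} {k : ℕ}

theorem mem_language_iff (M : CounterMachine T k) (w : List T) :
    w ∈ M.language ↔ ∃ c, Relation.ReflTransGen M.Step (M.initial w) c ∧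
      c.state ∈ M.accept ∧ c.input = [] := by
  constructor
  · rintro ⟨C, hC, hhead, c, hlast, hacc, hin⟩
    refine ⟨c, ?_, hacc, hin⟩
    cases C with
    | nil => simp at hhead
    | cons d C =>
      simp only [List.head?_cons, Option.some.injEq] at hhead
      subst hhead
      rw [List.getLast?_eq_some_getLast (by simp)] at hlast
      exact List.relationReflTransGen_of_exists_isChain_cons C hC (Option.some.inj hlast)
  · rintro ⟨c, h, hacc, hin⟩
    obtain ⟨C, hC, hlast⟩ := List.exists_isChain_cons_of_relationReflTransGen h
    exact ⟨_ :: C, hC, rfl, c, by rw [List.getLast?_eq_some_getLast (by simp), hlast], hacc, hin⟩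

/-- The moves of all counters in one step: the segments, the tests and the changes. -/
abbrev Moves (k m : ℕ) := (Fin k → Fin m) × (Fin k → Bool) × (Fin k → SignType)

/-- The move of one counter. -/
def Moves.proj {m : ℕ} (i : Fin k) (a : Moves k m) : Move := (a.1 i, a.2.1 i, a.2.2 i)

/-- The vector that counts the moves of a step. -/
def Moves.vec {m : ℕ} (a : Moves k m) : Fin k × Fin m × SignType → ℕ :=
  fun j => if (a.1 j.1, a.2.2 j.1) = j.2 then 1 else 0

/-- Paths in the transition graph of `M`, annotated by nondecreasing segments for each counter. -/
inductive Path (M : CounterMachine T k) (m : ℕ) :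
    M.State × (Fin k → Fin m) → List T → List (Moves k m) → M.State × (Fin k → Fin m) → Prop
  | nil (x : M.State × (Fin k → Fin m)) : Path M m x [] [] x
  | cons {t : CounterTransition T M.State k} {s s' : Fin k → Fin m} {w : List T}
      {l : List (Moves k m)} {y : M.State × (Fin k → Fin m)} (ht : t ∈ M.transitions)
      (hs : s ≤ s') (hc : ∀ i, (kind (s' i)).Compat (t.positive i) (t.change i))
      (h : Path M m (t.tgt, s') w l y) :
      Path M m (t.src, s) (t.read.toList ++ w) ((s', t.positive, t.change) :: l) y

/-- The transitions of the weighted automaton that counts the moves in each segment. -/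
def segmentTransitions (M : CounterMachine T k) (m : ℕ) :
    Set ((M.State × (Fin k → Fin m)) × Option T × (Fin k × Fin m × SignType → ℕ) ×
      (M.State × (Fin k → Fin m))) :=
  {x | ∃ t ∈ M.transitions, ∃ s s' : Fin k → Fin m, s ≤ s' ∧
    (∀ i, (kind (s' i)).Compat (t.positive i) (t.change i)) ∧
      x = ((t.src, s), t.read, Moves.vec (s', t.positive, t.change), (t.tgt, s'))}

variable {M : CounterMachine T k} {m : ℕ}

theorem finite_segmentTransitions : (M.segmentTransitions m).Finite := by
  refine ((M.transitions.finite_toSet.prod (Set.finite_univ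
    (α := (Fin k → Fin m) × (Fin k → Fin m)))).image fun x =>
      ((x.1.src, x.2.1), x.1.read, Moves.vec (x.2.2, x.1.positive, x.1.change),
        (x.1.tgt, x.2.2))).subset ?_
  rintro _ ⟨t, ht, s, s', -, -, rfl⟩
  exact ⟨(t, s, s'), ⟨ht, trivial⟩, rfl⟩

theorem exists_path_of_run {x y : M.State × (Fin k → Fin m)} {w : List T}
    {n : Fin k × Fin m × SignType → ℕ} (h : WeightedRun (M.segmentTransitions m) x w y n) :
    ∃ l, M.Path m x w l y ∧ n = (l.map Moves.vec).sum := by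
  induction h with
  | nil x => exact ⟨[], .nil x, rfl⟩
  | eps ht _ ih =>
    obtain ⟨l, hl, rfl⟩ := ih
    obtain ⟨t, ht, s, s', hs, hc, he⟩ := ht
    simp only [Prod.mk.injEq] at he
    obtain ⟨rfl, he, rfl, rfl⟩ := he
    refine ⟨(s', t.positive, t.change) :: l, ?_, by rw [List.map_cons, List.sum_cons]⟩
    have := Path.cons ht hs hc hl
    rwa [← he] at this
  | read ht _ ih =>
    obtain ⟨l, hl, rfl⟩ := ih
    obtain ⟨t, ht, s, s', hs, hc, he⟩ := ht
    simp only [Prod.mk.injEq] at he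
    obtain ⟨rfl, he, rfl, rfl⟩ := he
    refine ⟨(s', t.positive, t.change) :: l, ?_, by rw [List.map_cons, List.sum_cons]⟩
    have := Path.cons ht hs hc hl
    rwa [← he] at this

theorem Path.run {x y : M.State × (Fin k → Fin m)} {w : List T} {l : List (Moves k m)}
    (h : M.Path m x w l y) :
    WeightedRun (M.segmentTransitions m) x w y (l.map Moves.vec).sum := by
  induction h with
  | nil x => exact .nil x
  | @cons t s s' w l y ht hs hc _ ih =>
    rw [List.map_cons, List.sum_cons]
    have hm : ((t.src, s), t.read, Moves.vec (s', t.positive, t.change), (t.tgt, s')) ∈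
      M.segmentTransitions m := ⟨t, ht, s, s', hs, hc, rfl⟩
    cases hr : t.read with
    | none => rw [hr] at hm; exact .eps hm ih
    | some a => rw [hr] at hm; exact .read hm ih

theorem Path.le {x y : M.State × (Fin k → Fin m)} {w : List T} {l : List (Moves k m)}
    (h : M.Path m x w l y) (i : Fin k) : ∀ a ∈ l.map (Moves.proj i), (x.2 i : ℕ) ≤ a.1 := by
  induction h with
  | nil => simp
  | cons ht hs hc _ ih =>
    intro a ha
    rcases List.mem_cons.1 ha with rfl | ha
    · exact hs i
    · exact (Fin.le_def.1 (hs i)).trans (ih a ha)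

theorem Path.sorted {x y : M.State × (Fin k → Fin m)} {w : List T} {l : List (Moves k m)}
    (h : M.Path m x w l y) (i : Fin k) : Sorted (l.map (Moves.proj i)) := by
  induction h with
  | nil => exact List.Pairwise.nil
  | cons ht hs hc h ih => exact List.Pairwise.cons (h.le i) ih

theorem Path.compat {x y : M.State × (Fin k → Fin m)} {w : List T} {l : List (Moves k m)}
    (h : M.Path m x w l y) (i : Fin k) :
    ∀ a ∈ l.map (Moves.proj i), (kind a.1).Compat a.2.1 a.2.2 := by
  induction h with
  | nil => simp
  | cons ht hs hc _ ih =>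
    intro a ha
    rcases List.mem_cons.1 ha with rfl | ha
    · exact hc i
    · exact ih a ha

/-- A path records only tests and changes; validity for each counter separately is all that is
missing for a computation, as the counters do not interact. -/
theorem Path.exists_steps {x y : M.State × (Fin k → Fin m)} {w : List T} {l : List (Moves k m)}
    (h : M.Path m x w l y) (v : Fin k → ℕ) (hv : ∀ i, Valid (v i) (l.map (Moves.proj i))) :
    ∃ v', Relation.ReflTransGen M.Step ⟨x.1, w, v⟩ ⟨y.1, [], v'⟩ := by
  induction h generalizing v with
  | nil x => exact ⟨v, .refl⟩
  | @cons t s s' w l y ht hs hc _ ih =>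
    have hv' : ∀ i, (((v i : ℤ) + (t.change i : ℤ)).toNat : ℤ) = v i + t.change i := fun i =>
      Int.toNat_of_nonneg (hv i).2.1
    obtain ⟨v', h'⟩ := ih (fun i => ((v i : ℤ) + (t.change i : ℤ)).toNat) fun i => by
      rw [hv']
      exact (hv i).2.2
    refine ⟨v', .head ⟨t, ht, rfl, rfl, rfl, fun i => ⟨?_, hv' i⟩⟩ h'⟩
    have := (hv i).1
    simpa [Moves.proj] using this

/-- Segments are attached to a given computation move by move, with `ρ i` the number of reversals
already made by counter `i`. -/
theorem exists_path_of_isChain {l : ℕ} (hm : m = 3 * (l + 1))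
    {c d : CounterConfig T M.State k} {C : List (CounterConfig T M.State k)}
    (hC : (c :: C).IsChain M.Step) (hd : (c :: C).getLast? = some d) (hin : d.input = [])
    (ρ : Fin k → ℕ) (s : Fin k → Fin m) (hρ : ∀ i, PhaseInv (ρ i) (s i) (c.counter i))
    (hrev : ∀ i, counterReversals (decide (ρ i % 2 = 1))
      ((c :: C).map fun c => c.counter i) + ρ i ≤ l) :
    ∃ es s', M.Path m (c.state, s) c.input es (d.state, s') ∧
      ∀ i, LocalCheck (c.counter i) (es.map (Moves.proj i)) := by
  induction C generalizing c ρ s with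
  | nil =>
    simp only [List.getLast?_singleton, Option.some.injEq] at hd
    subst hd
    rw [hin]
    exact ⟨[], s, .nil _, fun _ => trivial⟩
  | cons c' C ih =>
    obtain ⟨⟨t, ht, hsrc, htgt, hinp, hcnt⟩, hC'⟩ := List.isChain_cons_cons.1 hC
    rw [List.getLast?_cons_cons] at hd
    have hrev' : ∀ i, counterReversals (decide (nextPhase (ρ i) (t.change i) % 2 = 1))
        ((c' :: C).map fun c => c.counter i) + nextPhase (ρ i) (t.change i) ≤ l := fun i => by
      have := hrev i
      simp only [List.map_cons] at this ⊢
      rwa [counterReversals_nextPhase (hcnt i).2]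
    have hseg := fun i => exists_segment (v := c.counter i) (Int.natCast_nonneg _) (hρ i)
      (b := t.positive i) (c := t.change i) (by simpa using (hcnt i).1)
      (by rw [← (hcnt i).2]; exact Int.natCast_nonneg _)
    choose s' h₁ h₂ h₃ h₄ h₅ h₆ using hseg
    -- At most `l` reversals leave the phases `0, …, l` with three segments each, whence `m = 3 * (l
    -- + 1)`.
    have hlt : ∀ i, s' i < m := fun i => by
      have := hrev' i
      have := h₂ i
      omega
    obtain ⟨es, s'', hp, hl⟩ := ih hC' hd (fun i => nextPhase (ρ i) (t.change i))
      (fun i => ⟨s' i, hlt i⟩) (fun i => by rw [(hcnt i).2]; exact h₆ i) hrev'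
    refine ⟨(fun i => ⟨s' i, hlt i⟩, t.positive, t.change) :: es, s'', ?_, fun i => ?_⟩
    · rw [hsrc, hinp]
      rw [htgt] at hp
      exact .cons ht h₁ h₃ hp
    · refine ⟨h₄ i, h₅ i, ?_⟩
      have := hl i
      rwa [(hcnt i).2] at this

/-- The linear function on the vectors that computes the sum of `g` over the moves of a counter. -/
def moveSum (i : Fin k) (g : ℕ → SignType → ℤ) : (Fin k × Fin m × SignType → ℕ) →+ ℤ where
  toFun x := ∑ p : Fin m × SignType, g p.1 p.2 * x (i, p)
  map_zero' := by simp
  map_add' x y := by simp [mul_add, Finset.sum_add_distrib]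

theorem moveSum_vec (i : Fin k) (g : ℕ → SignType → ℤ) (a : Moves k m) :
    moveSum i g a.vec = g (a.1 i) (a.2.2 i) := by
  simp only [moveSum, Moves.vec, AddMonoidHom.coe_mk, ZeroHom.coe_mk]
  rw [Finset.sum_eq_single (a.1 i, a.2.2 i)]
  · simp
  · intro b _ hb
    simp [hb.symm]
  · simp

theorem moveSum_sum_vec (i : Fin k) (g : ℕ → SignType → ℤ) (l : List (Moves k m)) :
    moveSum i g (l.map Moves.vec).sum = total g (l.map (Moves.proj i)) := by
  induction l with
  | nil => simp
  | cons a l ih =>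
    rw [List.map_cons, List.sum_cons, map_add, ih, moveSum_vec, List.map_cons, total_cons]
    rfl

/-- The vectors that satisfy the conditions of all segments. -/
def goodVectors (k m : ℕ) : Set (Fin k × Fin m × SignType → ℕ) :=
  {x | ∀ (i : Fin k) (s : Fin m), moveSum i (occurs s) x = 0 ∨
    (kind s).CheckBegin (moveSum i (before s) x) ∧ (kind s).CheckEnd (moveSum i (upTo s) x)}

theorem isSemilinearSet_Ici (a : ℤ) : IsSemilinearSet {x : ℤ | a ≤ x} := by
  refine (IsLinearSet.isSemilinearSet ⟨a, {1}, Set.finite_singleton _, ?_⟩)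
  ext x
  simp only [Set.mem_ofPred_eq, Set.mem_vadd_set, SetLike.mem_coe,
    AddSubmonoid.mem_closure_singleton]
  constructor
  · intro h
    exact ⟨x - a, ⟨(x - a).toNat, by simp [h]⟩, by simp⟩
  · rintro ⟨_, ⟨n, rfl⟩, rfl⟩
    simp

theorem isSemilinearSet_Iic (a : ℤ) : IsSemilinearSet {x : ℤ | x ≤ a} := by
  have : {x : ℤ | x ≤ a} = (-AddMonoidHom.id ℤ) ⁻¹' {x : ℤ | -a ≤ x} := by
    ext x; simp
  rw [this]
  exact (isSemilinearSet_Ici _).preimage _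

theorem isSemilinearSet_checkBegin (κ : Kind) : IsSemilinearSet {x : ℤ | κ.CheckBegin x} := by
  cases κ with
  | zero => exact IsSemilinearSet.singleton 0
  | jump => exact IsSemilinearSet.singleton 0
  -- On the integers, `0 < x` is by definition `1 ≤ x`; `down` below uses the same.
  | up => exact isSemilinearSet_Ici 1
  | down => exact IsSemilinearSet.univ
  | hit => exact IsSemilinearSet.univ

theorem isSemilinearSet_checkEnd (κ : Kind) : IsSemilinearSet {x : ℤ | κ.CheckEnd x} := by
  cases κ with
  | zero => exact IsSemilinearSet.univ
  | jump => exact isSemilinearSet_Iic 1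
  | up => exact IsSemilinearSet.univ
  | down => exact isSemilinearSet_Ici 1
  | hit => exact isSemilinearSet_Ici 0

/-- Each condition is the preimage of a point, a half-line or all of `ℤ` under an additive map, and
semilinear sets are closed under preimages and finite Boolean combinations of this kind. -/
theorem isSemilinearSet_goodVectors (k m : ℕ) : IsSemilinearSet (goodVectors k m) := by
  have : goodVectors k m = ⋂ (i : Fin k) (s : Fin m),
      ((moveSum i (occurs s)) ⁻¹' {0} ∪ ((moveSum i (before s)) ⁻¹' {x | (kind s).CheckBegin x} ∩
        (moveSum i (upTo s)) ⁻¹' {x | (kind s).CheckEnd x})) := by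
    ext x
    simp [goodVectors]
  rw [this]
  exact IsSemilinearSet.iInter fun i => IsSemilinearSet.iInter fun s =>
    ((IsSemilinearSet.singleton 0).preimage _).union
      (((isSemilinearSet_checkBegin _).preimage _).inter ((isSemilinearSet_checkEnd _).preimage _))

/-- Reversal-boundedness is needed from left to right, to annotate an accepting computation with
boundedly many segments. From right to left, the vector conditions alone make the path executable.
-/
theorem mem_language_iff_run {l : ℕ} (hM : M.IsReversalBounded l) (w : List T) :
    w ∈ M.language ↔
      ∃ p ∈ {x : M.State × (Fin k → Fin (3 * (l + 1))) | x = (M.start, fun _ => 0)},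
        ∃ q ∈ {x : M.State × (Fin k → Fin (3 * (l + 1))) | x.1 ∈ M.accept},
          ∃ n ∈ goodVectors k (3 * (l + 1)),
            WeightedRun (M.segmentTransitions (3 * (l + 1))) p w q n := by
  constructor
  · rintro ⟨C, hC⟩
    have hrev := hM w C hC
    obtain ⟨hC, hhead, d, hlast, hacc, hin⟩ := hC
    cases C with
    | nil => simp at hhead
    | cons c C =>
      simp only [List.head?_cons, Option.some.injEq] at hhead
      subst hhead
      obtain ⟨es, s', hp, hl⟩ := exists_path_of_isChain rfl hC hlast hin (fun _ => 0)
        (fun _ => 0) (fun i => ⟨by simp, by simp⟩) hrev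
      refine ⟨_, rfl, _, hacc, _, ?_, hp.run⟩
      intro i s
      simp only [moveSum_sum_vec]
      -- A segment that contains no move is exempt: its conditions may fail, for instance when a
      -- counter never enters it.
      by_cases h : total (occurs s) (es.map (Moves.proj i)) = 0
      · exact .inl h
      · obtain ⟨a, ha, has⟩ := exists_of_total_occurs_ne_zero h
        have hB := checkBegin_of_localCheck (hp.sorted i) (hl i) ha
        have hE := checkEnd_of_localCheck (hp.sorted i) (hl i) ha
        rw [has] at hB hE
        simp only [initial, Pi.zero_apply, Nat.cast_zero, zero_add] at hB hE
        exact .inr ⟨hB, hE⟩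
  · rintro ⟨_, rfl, q, hq, n, hn, hr⟩
    obtain ⟨es, hp, rfl⟩ := exists_path_of_run hr
    obtain ⟨v, hv⟩ := hp.exists_steps 0 fun i => by
      have := valid_append_of_check (pre := []) (hp.sorted i) (hp.compat i) fun a ha => by
        obtain ⟨e, he, rfl⟩ := List.mem_map.1 ha
        have := hn i (e.1 i)
        simp only [moveSum_sum_vec] at this
        -- The segment of a move that occurs is not exempt.
        exact this.resolve_left (total_occurs_pos ha rfl)
      simpa using this
    exact (M.mem_language_iff w).2 ⟨_, hv, hq, rfl⟩

end CounterMachine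

namespace Language

theorem IsUFIN.inf_isNCM {S : Type} [Finite S] {L₁ L₂ : Language S} (h₁ : L₁.IsUFIN)
    (h₂ : L₂.IsNCM) : (L₁ ⊓ L₂).IsUFINc := by
  obtain ⟨k, l, M, hM, rfl⟩ := h₂
  have := M.finiteState
  exact h₁.inf_isUFINc_of_isSemilinearSet (CounterMachine.finite_segmentTransitions) _ _
    (CounterMachine.isSemilinearSet_goodVectors _ _) (CounterMachine.mem_language_iff_run hM)

end Language

/-! ### A reversal-bounded machine that compares the numbers of occurrences of letters -/

namespace EqualCounts

open WeightedIndexed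

/-- The states of the machine: reading the input, emptying the counters, done. -/
inductive State
  | read | drain | done

instance : Finite State :=
  Finite.of_injective (β := Option Bool)
    (fun | .read => none | .drain => some true | .done => some false) fun x y h => by
      cases x <;> cases y <;> simp_all

variable {R : Type*} {k : ℕ}

/-- The change of the counters when a letter is read. -/
def letterChange : R ⊕ Fin k → Fin k → SignType
  | .inl _, _ => 0
  | .inr j, i => if j = i then 1 else 0

/-- The transitions of the machine. -/
inductive Rule : CounterTransition (R ⊕ Fin k) State k → Prop
  | read (s : R ⊕ Fin k) (b : Fin k → Bool) : Rule ⟨.read, some s, b, .read, letterChange s⟩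
  | turn (b : Fin k → Bool) : Rule ⟨.read, none, b, .drain, fun _ => 0⟩
  | drain : Rule ⟨.drain, none, fun _ => true, .drain, fun _ => -1⟩
  | done : Rule ⟨.drain, none, fun _ => false, .done, fun _ => 0⟩

theorem finite_rule [Finite R] : {t : CounterTransition (R ⊕ Fin k) State k | Rule t}.Finite := by
  let R₁ : Set (CounterTransition (R ⊕ Fin k) State k) :=
    Set.range fun x : (R ⊕ Fin k) × (Fin k → Bool) =>
      ⟨.read, some x.1, x.2, .read, letterChange x.1⟩
  let R₂ : Set (CounterTransition (R ⊕ Fin k) State k) :=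
    Set.range fun b : Fin k → Bool => ⟨.read, none, b, .drain, fun _ => 0⟩
  let R₃ : Set (CounterTransition (R ⊕ Fin k) State k) :=
    {⟨.drain, none, fun _ => true, .drain, fun _ => -1⟩,
      ⟨.drain, none, fun _ => false, .done, fun _ => 0⟩}
  have : (R₁ ∪ R₂ ∪ R₃).Finite :=
    ((Set.finite_range _).union (Set.finite_range _)).union (Set.toFinite _)
  refine this.subset fun t ht => ?_
  cases ht with
  | read s b => exact .inl (.inl ⟨(s, b), rfl⟩)
  | turn b => exact .inl (.inr ⟨b, rfl⟩)
  | drain => exact .inr (.inl rfl)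
  | done => exact .inr (.inr rfl)

/-- A machine that accepts the words in which all letters of `Fin k` occur equally often. -/
noncomputable def machine (R : Type*) [Finite R] (k : ℕ) : CounterMachine (R ⊕ Fin k) k where
  State := State
  finiteState := inferInstance
  start := .read
  accept := {.done}
  transitions := finite_rule.toFinset

theorem counterCount_cons (s : R ⊕ Fin k) (w : List (R ⊕ Fin k)) (i : Fin k) :
    (counterCount (s :: w) i : ℤ) = counterCount w i + letterChange s i := by
  rcases s with a | j
  · simp [counterCount, letterChange]
  · by_cases h : j = i <;> simp [counterCount, letterChange, h]

variable [Finite R]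

/-- A step of the machine from a rule. -/
theorem step_of_rule {t : CounterTransition (R ⊕ Fin k) State k} (ht : Rule t)
    {w : List (R ⊕ Fin k)} {v v' : Fin k → ℕ} (h₁ : ∀ i, 0 < v i ↔ t.positive i = true)
    (h₂ : ∀ i, (v' i : ℤ) = v i + t.change i) :
    (machine R k).Step ⟨t.src, t.read.toList ++ w, v⟩ ⟨t.tgt, w, v'⟩ :=
  ⟨t, finite_rule.mem_toFinset.2 ht, rfl, rfl, rfl, fun i => ⟨h₁ i, h₂ i⟩⟩

theorem reads (w : List (R ⊕ Fin k)) (v : Fin k → ℕ) :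
    Relation.ReflTransGen (machine R k).Step ⟨.read, w, v⟩
      ⟨.read, [], v + counterCount w⟩ := by
  induction w generalizing v with
  | nil => exact .refl
  | cons s w ih =>
    have h₁ := step_of_rule (Rule.read s fun i => decide (0 < v i)) (w := w) (v := v)
      (v' := v + counterCount [s]) (by simp) fun i => by
        simp only [Pi.add_apply, Nat.cast_add, counterCount_cons]
        simp [counterCount]
    have h₂ := ih (v + counterCount [s])
    rw [add_assoc, ← counterCount_append] at h₂
    exact .head h₁ h₂

theorem drains (n : ℕ) :
    Relation.ReflTransGen (machine R k).Step ⟨.drain, [], fun _ => n⟩ ⟨.drain, [], fun _ => 0⟩ := by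
  induction n with
  | zero => exact .refl
  | succ n ih =>
    exact .head (step_of_rule Rule.drain (w := []) (v := fun _ => n + 1) (v' := fun _ => n)
      (by simp) (by simp)) ih

/-- Reading never decreases a counter and draining never increases one. Outside the reading state
both flags are considered: the flag is still `false` on entering `drain`, and becomes `true` with
the first decrement, after which no reversal follows. -/
theorem machine_reversals {c : CounterConfig (R ⊕ Fin k) State k}
    {C : List (CounterConfig (R ⊕ Fin k) State k)}
    (h : List.IsChain (machine R k).Step (c :: C)) (i : Fin k) :
    (c.state = .read → counterReversals false ((c :: C).map fun c => c.counter i) ≤ 1) ∧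
      (c.state ≠ .read → counterReversals true ((c :: C).map fun c => c.counter i) = 0 ∧
        counterReversals false ((c :: C).map fun c => c.counter i) ≤ 1) := by
  induction C generalizing c with
  | nil => simp [counterReversals]
  | cons d C ih =>
    obtain ⟨⟨t, ht, hsrc, htgt, -, hcnt⟩, hC⟩ := List.isChain_cons_cons.1 h
    obtain ⟨ih₁, ih₂⟩ := ih hC
    have ht : Rule t := finite_rule.mem_toFinset.1 ht
    have hd := (hcnt i).2
    simp only [List.map_cons] at ih₁ ih₂ ⊢
    cases ht with
    | read s b =>
      refine ⟨fun _ => ?_, fun h => absurd hsrc h⟩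
      have h₁ := ih₁ htgt
      have hle : c.counter i ≤ d.counter i := by
        have : 0 ≤ (letterChange s i : ℤ) := by
          rcases s with a | j
          · simp [letterChange]
          · simp only [letterChange]; split <;> simp
        simp only at hd
        omega
      rw [counterReversals]
      rcases hle.lt_or_eq with h | h
      · simpa [h] using h₁
      · simpa [h] using h₁
    | turn b =>
      refine ⟨fun _ => ?_, fun h => absurd hsrc h⟩
      have h₁ := (ih₂ (by rw [htgt]; simp)).2
      have h : c.counter i = d.counter i := by simpa using hd.symm
      rw [counterReversals]
      simpa [h] using h₁
    | drain =>
      refine ⟨fun h => by rw [hsrc] at h; simp at h, fun _ => ?_⟩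
      have h₁ := (ih₂ (by rw [htgt]; simp)).1
      have h : d.counter i < c.counter i := by
        simp at hd; omega
      rw [counterReversals, counterReversals]
      simp [h, h.not_gt, h₁]
    | done =>
      refine ⟨fun h => by rw [hsrc] at h; simp at h, fun _ => ?_⟩
      have h₁ := ih₂ (by rw [htgt]; simp)
      have h : c.counter i = d.counter i := by simpa using hd.symm
      rw [counterReversals, counterReversals]
      simpa [h] using h₁

theorem machine_isReversalBounded : (machine R k).IsReversalBounded 1 := by
  rintro w C ⟨hC, hhead, -⟩ i
  cases C with
  | nil => simp at hhead
  | cons c C =>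
    simp only [List.head?_cons, Option.some.injEq] at hhead
    exact (machine_reversals hC i).1 (by rw [hhead]; rfl)

/-- The condition for acceptance from a configuration. -/
def Good (c : CounterConfig (R ⊕ Fin k) State k) : Prop :=
  (c.state = .read → ∀ i j, c.counter i + counterCount c.input i =
    c.counter j + counterCount c.input j) ∧
  (c.state = .drain → c.input = [] ∧ ∀ i j, c.counter i = c.counter j) ∧
  (c.state = .done → c.input = [])

/-- The invariant is carried backwards from acceptance. All counters are zero at the last move out
of `drain`, and every drain move lowers all of them by one, so they were equal when draining began.
-/
theorem good_of_reflTransGen {c d : CounterConfig (R ⊕ Fin k) State k}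
    (h : Relation.ReflTransGen (machine R k).Step c d) (hd : d.state = .done)
    (hin : d.input = []) : Good c := by
  induction h using Relation.ReflTransGen.head_induction_on with
  | refl => simp [Good, hd, hin]
  | @head a b hab _ ih =>
    obtain ⟨t, ht, hsrc, htgt, hinp, hcnt⟩ := hab
    obtain ⟨ih₁, ih₂, ih₃⟩ := ih
    have ht : Rule t := finite_rule.mem_toFinset.1 ht
    cases ht with
    | read s b' =>
      refine ⟨fun _ i j => ?_, by simp [hsrc], by simp [hsrc]⟩
      have h := ih₁ htgt i j
      have hi := (hcnt i).2
      have hj := (hcnt j).2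
      simp only [Option.toList_some, List.cons_append, List.nil_append] at hinp hi hj
      have ci := counterCount_cons s b.input i
      have cj := counterCount_cons s b.input j
      rw [hinp]
      omega
    | turn b' =>
      refine ⟨fun _ i j => ?_, by simp [hsrc], by simp [hsrc]⟩
      obtain ⟨h, he⟩ := ih₂ htgt
      have hi := (hcnt i).2
      have hj := (hcnt j).2
      simp only [Option.toList_none, List.nil_append, SignType.coe_zero, add_zero] at hinp hi hj
      have := he i j
      rw [hinp, h]
      simp [counterCount]
      omega
    | drain =>
      refine ⟨by simp [hsrc], fun _ => ?_, by simp [hsrc]⟩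
      obtain ⟨h, he⟩ := ih₂ htgt
      refine ⟨by rw [hinp, h]; rfl, fun i j => ?_⟩
      have hi := (hcnt i).2
      have hj := (hcnt j).2
      have := he i j
      simp only at hi hj
      omega
    | done =>
      refine ⟨by simp [hsrc], fun _ => ?_, by simp [hsrc]⟩
      refine ⟨by rw [hinp, ih₃ htgt]; rfl, fun i j => ?_⟩
      have hi := (hcnt i).1
      have hj := (hcnt j).1
      simp only [Bool.false_eq_true, iff_false, not_lt, nonpos_iff_eq_zero] at hi hj
      rw [hi, hj]

theorem machine_language : (machine R k).language = Language.equalCounts R k := by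
  ext w
  rw [CounterMachine.mem_language_iff]
  constructor
  · rintro ⟨c, h, hacc, hin⟩ i j
    have := (good_of_reflTransGen h hacc hin).1 rfl i j
    simpa [CounterMachine.initial] using this
  · intro hw
    obtain ⟨n, hn⟩ : ∃ n : ℕ, counterCount w = fun _ => n := by
      -- Without counters there is none from which to take the common value, and any `n` will do.
      rcases isEmpty_or_nonempty (Fin k) with h | ⟨⟨i⟩⟩
      · exact ⟨0, Subsingleton.elim _ _⟩
      · exact ⟨counterCount w i, funext fun j => hw j i⟩
    refine ⟨⟨.done, [], fun _ => 0⟩, ?_, rfl, rfl⟩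
    have h₁ := reads w (0 : Fin k → ℕ)
    rw [zero_add, hn] at h₁
    have h₂ : (machine R k).Step ⟨.read, [], fun _ => n⟩ ⟨.drain, [], fun _ => n⟩ :=
      step_of_rule (Rule.turn fun _ => decide (0 < n)) (w := []) (by simp) (by simp)
    have h₃ : (machine R k).Step ⟨.drain, [], fun _ => 0⟩ ⟨.done, [], fun _ => 0⟩ :=
      step_of_rule Rule.done (w := []) (by simp) (by simp)
    exact ((h₁.tail h₂).trans (drains n)).tail h₃

end EqualCounts

theorem Language.equalCounts_isNCM (R : Type*) [Finite R] (k : ℕ) :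
    (Language.equalCounts R k).IsNCM :=
  ⟨k, 1, EqualCounts.machine R k, EqualCounts.machine_isReversalBounded,
    EqualCounts.machine_language⟩

theorem mainTheorem7 {T : Type*} [Finite T] (L : Language T) :
    L.IsUFINc ↔
      ∃ (S : Type) (_ : Finite S) (h : FreeMonoid S →* FreeMonoid T) (L₁ L₂ : Language S),
        L₁.IsUFIN ∧ L₂.IsNCM ∧ L = Language.homImage h (L₁ ⊓ L₂) := by
  constructor
  · intro hL
    obtain ⟨n, k, h, L₁, h₁, rfl⟩ := hL.exists_homImage
    exact ⟨Fin n ⊕ Fin k, inferInstance, h, L₁, _, h₁, Language.equalCounts_isNCM _ _, rfl⟩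
  · rintro ⟨S, _, h, L₁, L₂, h₁, h₂, rfl⟩
    exact (h₁.inf_isNCM h₂).homImage h
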